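/- **Setting.** Let $G=(V,E)$ be a finite simple graph with $n=|V|$, let $\mathcal J=(J_e)_{e\in E}$ be real couplings and $\beta>0$. Let $\mu=\mu_{G,\mathcal J,\beta}$ be the probability distribution on $\{\pm1\}^V$ with $$\mu(\sigma)\propto\exp\Big(\beta\sum_{\{x,y\}\in E}\mathbf 1\{\sigma(x)=\sigma(y)\}\,J_{\{x,y\}}\Big).$$ Put $\beta_c(d)=\sqrt{2\pi}/d$, $\Gamma_e=\frac{|1-e^{\beta J_e}|}{1+e^{\beta J_e}}$ and $A(u)=\sum_{w\sim u}\Gamma_{\{u,w\}}$. For $d,\varepsilon>0$ the weight of a vertex $u$ is $M(u)=1-\varepsilon/4$ if $A(u)\le 1-\varepsilon/2$, and $M(u)=d\,A(u)$ otherwise; the weight $M(P)$ of a path $P$ is the product of the weights of its vertices. A vertex $u$ is a *$(d,\varepsilon)$-block vertex* if $M(P)<1$ for every path $P$ of length at most $\log n$ starting at $u$. For $B\subseteq V$ let $\partial_{\rm out}B$ be the set of vertices outside $B$ that have a neighbour in $B$. A partition $\mathcal B=\{B_1,\dots,B_N\}$ of $V$ is a *$(d,\varepsilon)$-block partition* if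 every $B\in\mathcal B$ induces a tree with at most one extra edge; every single-vertex block consists of a $(d,\varepsilon)$-block vertex; and for every multi-vertex block $B$: every $w\in\partial_{\rm out}B$ is a $(d,\varepsilon)$-block vertex and has exactly one neighbour in $B$, and a cycle in $B$, if there is one, has length at most $4\frac{\log n}{\log^4 d}$ and distance at least $\log^5 d$ from $\partial_{\rm out}B$. $\mathcal G(d,\varepsilon)$ is the set of triplets $(G,\mathcal J,\beta)$ such that (1) $G$ admits a $(d,\varepsilon)$-block partition; (2) every path $P$ in $G$ of length at most $\frac{\log n}{\log^4 d}$ satisfies $\beta\sum_{e}|J_e|+\sum_{v\in P}\log\deg(v)\le\frac{\log n}{\log^2 d}$, where $e$ runs over the edges with at least one endpoint in $P$ (and $\log 0$ is read as $0$); (3) $n^{-7/3}\le|J_e|\le10\sqrt{\log n}$ for every $e\in E$. The *block dynamics* for $\mu$ and $\mathcal B$ is the Markov chain on $\{\pm1\}^V$ that at each step chooses a block $B\in\mathcal B$ uniformly at random and resamples the configuration of $B$ from $\mu$ conditional on the current configuration outside $B$. With $P$ its transition matrix, its mixing time is $T_{\rm Mix}=\max_\sigma\min\{t>0:\|P^t(\sigma,\cdot)-\mu\|_{\rm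 TV}\le1/e\}$. **Theorem.** For every $\varepsilon>0$ there is $d_0=d_0(\varepsilon)\ge1$ such that for all $d\ge d_0$ and all $0<\beta\le(1-\varepsilon)\beta_c(d)$ the following holds. (i) For every $(G,\mathcal J,\beta)\in\mathcal G(d,\varepsilon)$ there is $C>0$ such that, for every $(d,\varepsilon)$-block partition $\mathcal B$ of $G$ into $N\ge2$ blocks, the block dynamics for $\mu_{G,\mathcal J,\beta}$ and $\mathcal B$ satisfies $T_{\rm Mix}\le C\,N\log N$. (ii) The constant is uniform in $G$ and $\mathcal J$ as soon as $N=\Omega(\sqrt n)$: for every $c>0$ there is $C=C(\varepsilon,d,\beta,c)>0$ such that, for every $(G,\mathcal J,\beta)\in\mathcal G(d,\varepsilon)$ and every $(d,\varepsilon)$-block partition $\mathcal B$ of $G$ into $N\ge2$ blocks with $N\ge c\sqrt n$, the block dynamics satisfies $T_{\rm Mix}\le C\,N\log N$. -/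

import Mathlib

universe u

noncomputable section

namespace EASpinGlass

/-! ### Finite Markov chains -/

/-- Total variation distance between two distributions on a finite set. -/
def tvDist {Ω : Type*} [Fintype Ω] (p q : Ω → ℝ) : ℝ :=
  (1 / 2) * ∑ x, |p x - q x|

/-- The mixing time `max_σ min {t > 0 : ‖P ^ t (σ, ·) - μ‖_TV ≤ 1 / e}` of the chain with
transition matrix `P`; the value is `⊤` if from some starting state no such `t` exists. -/
def mixingTime {Ω : Type*} [Fintype Ω] [DecidableEq Ω] (P : Matrix Ω Ω ℝ) (μ : Ω → ℝ) : ℕ∞ :=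
  ⨆ σ : Ω, ⨅ t : {t : ℕ // 0 < t ∧ tvDist ((P ^ t) σ) μ ≤ 1 / Real.exp 1}, ((t : ℕ) : ℕ∞)

section Model

variable {V : Type u} [Fintype V] [DecidableEq V]

/-! ### The glassy Gibbs distribution and the block dynamics

Configurations are functions `V → ℤˣ`, where `ℤˣ = {1, -1}`. Couplings are indexed by unordered
pairs, but only their values at edges of the graph are ever used. -/

open Classical in
/-- `∑_{x ∼ y} 1{σ(x) = σ(y)} J_{x,y}`, each edge counted once. -/
def interaction (G : SimpleGraph V) (J : Sym2 V → ℝ) (σ : V → ℤˣ) : ℝ :=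
  ∑ e ∈ G.edgeFinset, if (∀ x ∈ e, ∀ y ∈ e, σ x = σ y) then J e else 0

/-- The Gibbs distribution `μ_{G,J,β}`. -/
def gibbs (G : SimpleGraph V) (J : Sym2 V → ℝ) (β : ℝ) (σ : V → ℤˣ) : ℝ :=
  Real.exp (β * interaction G J σ) / ∑ τ : V → ℤˣ, Real.exp (β * interaction G J τ)

open Classical in
/-- The probability of moving from `σ` to `τ` when the block `B` is resampled from `μ`
conditionally on the configuration `σ` outside `B`. -/
def blockUpdate (μ : (V → ℤˣ) → ℝ) (B : Finset V) (σ τ : V → ℤˣ) : ℝ :=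
  if ∀ v, v ∉ B → τ v = σ v then
    μ τ / ∑ τ' : V → ℤˣ, (if ∀ v, v ∉ B → τ' v = σ v then μ τ' else 0)
  else 0

/-- Transition matrix of the block dynamics: a uniformly random block is resampled. -/
def blockDynamics (μ : (V → ℤˣ) → ℝ) (𝓑 : Finpartition (Finset.univ : Finset V)) :
    Matrix (V → ℤˣ) (V → ℤˣ) ℝ :=
  fun σ τ => (1 / (𝓑.parts.card : ℝ)) * ∑ B ∈ 𝓑.parts, blockUpdate μ B σ τ

/-! ### Influences and weights -/

/-- The critical inverse temperature `β_c(d) = √(2π) / d`. -/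
def betaC (d : ℝ) : ℝ := Real.sqrt (2 * Real.pi) / d

/-- The influence `Γ_e` of the edge `e`. -/
def influence (J : Sym2 V → ℝ) (β : ℝ) (e : Sym2 V) : ℝ :=
  |1 - Real.exp (β * J e)| / (1 + Real.exp (β * J e))

open Classical in
/-- The aggregate influence `A(u) = ∑_{w ∼ u} Γ_{u,w}`. -/
def aggInfluence (G : SimpleGraph V) (J : Sym2 V → ℝ) (β : ℝ) (u : V) : ℝ :=
  ∑ w ∈ G.neighborFinset u, influence J β s(u, w)

open Classical in
/-- The `(d, ε)`-vertex weight. -/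
def vertexWeight (G : SimpleGraph V) (J : Sym2 V → ℝ) (β d ε : ℝ) (u : V) : ℝ :=
  if aggInfluence G J β u ≤ 1 - ε / 2 then 1 - ε / 4 else d * aggInfluence G J β u

/-- The `(d, ε)`-path weight: the product of the weights of the vertices of the path. -/
def pathWeight (G : SimpleGraph V) (J : Sym2 V → ℝ) (β d ε : ℝ) {u v : V} (p : G.Walk u v) : ℝ :=
  (p.support.map (vertexWeight G J β d ε)).prod

/-- `u` is a `(d, ε)`-block vertex: every path of length at most `log n` that starts at `u` has
weight less than `1`, where `n` is the number of vertices. -/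
def IsBlockVertex (G : SimpleGraph V) (J : Sym2 V → ℝ) (β d ε : ℝ) (u : V) : Prop :=
  ∀ (v : V) (p : G.Walk u v), p.IsPath → (p.length : ℝ) ≤ Real.log (Fintype.card V) →
    pathWeight G J β d ε p < 1

/-! ### Block partitions -/

/-- The outer boundary of `B`: the vertices outside `B` with a neighbour in `B`. -/
def outerBoundary (G : SimpleGraph V) (B : Finset V) : Set V :=
  {w | w ∉ B ∧ ∃ v ∈ B, G.Adj w v}

/-- `H` is a tree with at most one extra edge. -/
def IsTreePlusAtMostOneEdge {W : Type*} (H : SimpleGraph W) : Prop :=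
  ∃ T : SimpleGraph W, T ≤ H ∧ T.IsTree ∧ (H.edgeSet \ T.edgeSet).Subsingleton

/-- `𝓑` is a `(d, ε)`-block partition of `G`. In the last field of the structure the distance is
between vertices of the same component, because blocks are connected. -/
structure IsBlockPartition (G : SimpleGraph V) (J : Sym2 V → ℝ) (β d ε : ℝ)
    (𝓑 : Finpartition (Finset.univ : Finset V)) : Prop where
  tree_or_unicyclic : ∀ B ∈ 𝓑.parts, IsTreePlusAtMostOneEdge (G.induce (B : Set V))
  single_vertex : ∀ B ∈ 𝓑.parts, B.card = 1 → ∀ v ∈ B, IsBlockVertex G J β d ε v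
  boundary_blockVertex : ∀ B ∈ 𝓑.parts, 1 < B.card →
    ∀ w ∈ outerBoundary G B, IsBlockVertex G J β d ε w
  boundary_unique_neighbour : ∀ B ∈ 𝓑.parts, 1 < B.card →
    ∀ w ∈ outerBoundary G B, ∃! v, v ∈ B ∧ G.Adj w v
  cycle_short : ∀ B ∈ 𝓑.parts, 1 < B.card →
    ∀ (v : V) (c : G.Walk v v), c.IsCycle → (∀ x ∈ c.support, x ∈ B) →
      (c.length : ℝ) ≤ 4 * (Real.log (Fintype.card V) / Real.log d ^ 4)
  cycle_far : ∀ B ∈ 𝓑.parts, 1 < B.card →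
    ∀ (v : V) (c : G.Walk v v), c.IsCycle → (∀ x ∈ c.support, x ∈ B) →
      ∀ x ∈ c.support, ∀ w ∈ outerBoundary G B, Real.log d ^ 5 ≤ (G.dist x w : ℝ)

/-! ### The class of triplets -/

open Classical in
/-- The path weight `β ∑_e |J_e| + ∑_v log deg v`; the first sum is over the edges of `G` with at
least one endpoint in the path, the second one over the vertices of the path. -/
def comparisonWeight (G : SimpleGraph V) (J : Sym2 V → ℝ) (β : ℝ) {u v : V} (p : G.Walk u v) : ℝ :=
  β * (∑ e ∈ G.edgeFinset with (∃ x ∈ p.support, x ∈ e), |J e|) +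
    (p.support.map (fun x => Real.log (G.degree x))).sum

/-- The three properties that define the class `𝒢(d, ε)` of triplets `(G, J, β)`. -/
structure InClass (d ε : ℝ) (G : SimpleGraph V) (J : Sym2 V → ℝ) (β : ℝ) : Prop where
  exists_blockPartition : ∃ 𝓑 : Finpartition (Finset.univ : Finset V),
    IsBlockPartition G J β d ε 𝓑
  path_weight_le : ∀ (u v : V) (p : G.Walk u v), p.IsPath →
    (p.length : ℝ) ≤ Real.log (Fintype.card V) / Real.log d ^ 4 →
      comparisonWeight G J β p ≤ Real.log (Fintype.card V) / Real.log d ^ 2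
  coupling_bounds : ∀ e ∈ G.edgeSet,
    (Fintype.card V : ℝ) ^ (-(7 / 3) : ℝ) ≤ |J e| ∧
      |J e| ≤ 10 * Real.sqrt (Real.log (Fintype.card V))

/-- The mixing time of the block dynamics for `μ_{G,J,β}` with blocks `𝓑`. -/
def blockMixingTime (G : SimpleGraph V) (J : Sym2 V → ℝ) (β : ℝ)
    (𝓑 : Finpartition (Finset.univ : Finset V)) : ℕ∞ :=
  mixingTime (blockDynamics (gibbs G J β) 𝓑) (gibbs G J β)

end Model

end EASpinGlass

end

/-!
The block dynamics is shown to contract a weighted total oscillation of functions by a factor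
`1 - δ / N` at each step. As the weights and their inverses are polynomial in `n`, this gives mixing
in time `O(N log n)`, which is `O(N log N)` when `N ≥ c √n`; for a single graph the last condition
holds for some `c`.

*Influence through a block.* A spin flip at a vertex `u` outside `B` changes the fields at its
neighbours in `B`. Changing the field at one vertex `v` only changes the law of the spin at `v`, and
this by at most `Γ` (`abs_tilt_sub_le`); given that spin, `v` is a boundary vertex of `B \ {v}`.
Iterating, the influence of `u` on `x ∈ B` is at most the sum over self-avoiding paths from `u` to `x`
through `B` of the products of `Γ` (`abs_condMean_update_sub_le`). No assumption on `B` is needed.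

*Exits of a block.* Let `k` be the integer part of `log n`, and let `y` be a vertex of a multi-vertex
block with a neighbour outside, which is a block vertex. The paths from `y` through the block to its
outer boundary are split by length. The aggregate influence of a vertex is at most `gap ε < 1` times
its weight. If the first `k` and the last `k` vertices cover the path, the weight conditions at both
ends bound the product of the aggregate influences along it, and a Kraft inequality (`pathSum_le`)
bounds the sum over all such paths (`pathSum_exitInfluence_short_le`). For longer paths, the two
edges of the path at a vertex share its aggregate influence, so that each of the `2 k - 1` inner
vertices used gains a factor `1 / 2` (`pathProd_long_le`). A path has weight at most a constant times
`4 ^ (-k)`, and since there are at most three paths to each exit (`card_sawLists_getLastD_le`), the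
total is of order `n ^ (1 - log 4)`. This is small for large `n`; the vertex `y` has degree at least
two, so `n` is large by the bound on degrees in the definition of the class
(`InClass.log_card_ge`).

*Weights.* A disagreement at `x` weighs its influence on the other blocks, corrected by a factor
`1 / (1 - ε / 4)` at the vertices that are not block vertices, plus a small constant. The bounds on
exits then say that a disagreement at the boundary of a block causes a total weight in the block
that is smaller by the factor `1 - δ` (`pathSum_boundaryWeight_le`,
`abs_blockDynamics_mulVec_sub_le`).
-/

noncomputable section

namespace EASpinGlass

open Function

/-! ### Conditional means on fibers -/

section Fibers

variable {V : Type*} [Fintype V] [DecidableEq V]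

open Classical in
/-- The sum of `φ` over the configurations that agree with `σ` off `B`. -/
def fiberSum (B : Finset V) (σ : V → ℤˣ) (φ : (V → ℤˣ) → ℝ) : ℝ :=
  ∑ τ : V → ℤˣ, if ∀ v, v ∉ B → τ v = σ v then φ τ else 0

/-- The mean of `f` under the distribution proportional to `W`, conditioned on the configuration
`σ` off `B`. -/
def condMean (W : (V → ℤˣ) → ℝ) (B : Finset V) (f : (V → ℤˣ) → ℝ) (σ : V → ℤˣ) : ℝ :=
  fiberSum B σ (fun τ => W τ * f τ) / fiberSum B σ W

theorem fiberSum_pos {B : Finset V} {σ : V → ℤˣ} {φ : (V → ℤˣ) → ℝ} (h : ∀ τ, 0 < φ τ) :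
    0 < fiberSum B σ φ := by
  classical
  refine Finset.sum_pos' (fun τ _ => ?_) ⟨σ, Finset.mem_univ _, ?_⟩
  · split_ifs
    exacts [(h τ).le, le_rfl]
  · simpa using h σ

theorem fiberSum_mono {B : Finset V} {σ : V → ℤˣ} {φ ψ : (V → ℤˣ) → ℝ}
    (h : ∀ τ, (∀ v, v ∉ B → τ v = σ v) → φ τ ≤ ψ τ) : fiberSum B σ φ ≤ fiberSum B σ ψ := by
  classical
  refine Finset.sum_le_sum fun τ _ => ?_
  split_ifs with hτ
  exacts [h τ hτ, le_rfl]

theorem fiberSum_congr {B : Finset V} {σ : V → ℤˣ} {φ ψ : (V → ℤˣ) → ℝ}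
    (h : ∀ τ, (∀ v, v ∉ B → τ v = σ v) → φ τ = ψ τ) : fiberSum B σ φ = fiberSum B σ ψ :=
  le_antisymm (fiberSum_mono fun τ hτ => (h τ hτ).le) (fiberSum_mono fun τ hτ => (h τ hτ).ge)

theorem fiberSum_congr_config {B : Finset V} {σ σ' : V → ℤˣ} (φ : (V → ℤˣ) → ℝ)
    (h : ∀ v, v ∉ B → σ v = σ' v) : fiberSum B σ φ = fiberSum B σ' φ := by
  classical
  refine Finset.sum_congr rfl fun τ _ => ?_
  congr 1
  exact propext (forall₂_congr fun v hv => by rw [h v hv])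

theorem fiberSum_mul_left (B : Finset V) (σ : V → ℤˣ) (c : ℝ) (φ : (V → ℤˣ) → ℝ) :
    fiberSum B σ (fun τ => c * φ τ) = c * fiberSum B σ φ := by
  classical
  simp [fiberSum, Finset.mul_sum]

theorem fiberSum_sub (B : Finset V) (σ : V → ℤˣ) (φ ψ : (V → ℤˣ) → ℝ) :
    fiberSum B σ (fun τ => φ τ - ψ τ) = fiberSum B σ φ - fiberSum B σ ψ := by
  classical
  rw [fiberSum, fiberSum, fiberSum, ← Finset.sum_sub_distrib]
  refine Finset.sum_congr rfl fun τ _ => ?_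
  split_ifs <;> simp

/-- The configurations that agree with `σ` off `B`, split according to the spin at `v ∈ B`. -/
theorem fiberSum_split {B : Finset V} {v : V} (hv : v ∈ B) (σ : V → ℤˣ) (φ : (V → ℤˣ) → ℝ) :
    fiberSum B σ φ = fiberSum (B.erase v) (update σ v 1) φ +
      fiberSum (B.erase v) (update σ v (-1)) φ := by
  classical
  rw [fiberSum, fiberSum, fiberSum, ← Finset.sum_add_distrib]
  refine Finset.sum_congr rfl fun τ _ => ?_
  have key : ∀ s : ℤˣ, (∀ x, x ∉ B.erase v → τ x = update σ v s x) ↔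
      (τ v = s ∧ ∀ x, x ∉ B → τ x = σ x) := by
    intro s
    constructor
    · intro h
      refine ⟨by simpa using h v (by simp), fun x hx => ?_⟩
      have hxv : x ≠ v := fun e => hx (e ▸ hv)
      simpa [hxv] using h x (fun hx' => hx (Finset.mem_of_mem_erase hx'))
    · rintro ⟨h1, h2⟩ x hx
      by_cases hxv : x = v
      · subst hxv; simpa using h1
      · rw [update_of_ne hxv]
        exact h2 x fun hB => hx (Finset.mem_erase.2 ⟨hxv, hB⟩)
  simp only [key]
  rcases Int.units_eq_one_or (τ v) with h | h <;> simp [h]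

/-- Flipping a boundary spin moves the fiber by the corresponding flip. -/
theorem fiberSum_update {B : Finset V} {u : V} (hu : u ∉ B) (σ : V → ℤˣ)
    (φ : (V → ℤˣ) → ℝ) (s t : ℤˣ) :
    fiberSum B (update σ u s) φ = fiberSum B (update σ u t) (fun τ => φ (update τ u s)) := by
  classical
  have key : ∀ (s t : ℤˣ) (τ : V → ℤˣ), (∀ x, x ∉ B → τ x = update σ u s x) →
      (∀ x, x ∉ B → update τ u t x = update σ u t x) := by
    intro s t τ h x hx
    by_cases hxu : x = u
    · subst hxu; simp
    · simpa [hxu] using h x hx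
  have key2 : ∀ (s t : ℤˣ) (τ : V → ℤˣ), (∀ x, x ∉ B → τ x = update σ u s x) →
      update (update τ u t) u s = τ := by
    intro s t τ h
    have := h u hu
    simp only [update_self] at this
    rw [update_idem, ← this, update_eq_self]
  rw [fiberSum, fiberSum, ← Finset.sum_filter, ← Finset.sum_filter]
  refine Finset.sum_nbij' (fun τ => update τ u t) (fun τ => update τ u s) ?_ ?_ ?_ ?_ ?_
  · intro τ hτ
    simp only [Finset.mem_filter, Finset.mem_univ, true_and] at hτ ⊢
    exact key s t τ hτ
  · intro τ hτ
    simp only [Finset.mem_filter, Finset.mem_univ, true_and] at hτ ⊢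
    exact key t s τ hτ
  · intro τ hτ
    simp only [Finset.mem_filter, Finset.mem_univ, true_and] at hτ
    exact key2 s t τ hτ
  · intro τ hτ
    simp only [Finset.mem_filter, Finset.mem_univ, true_and] at hτ
    exact key2 t s τ hτ
  · intro τ hτ
    simp only [Finset.mem_filter, Finset.mem_univ, true_and] at hτ
    simp only [key2 s t τ hτ]

theorem abs_condMean_sub_le {W : (V → ℤˣ) → ℝ} (hW : ∀ τ, 0 < W τ) {B : Finset V}
    {f f' : (V → ℤˣ) → ℝ} {σ : V → ℤˣ} {c : ℝ}
    (h : ∀ τ, (∀ v, v ∉ B → τ v = σ v) → |f τ - f' τ| ≤ c) :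
    |condMean W B f σ - condMean W B f' σ| ≤ c := by
  have hZ : 0 < fiberSum B σ W := fiberSum_pos hW
  rw [condMean, condMean, ← sub_div, ← fiberSum_sub, abs_div, abs_of_pos hZ, div_le_iff₀ hZ,
    ← fiberSum_mul_left, abs_le]
  constructor
  · rw [neg_le, ← neg_one_mul, ← fiberSum_mul_left]
    refine fiberSum_mono fun τ hτ => ?_
    nlinarith [hW τ, (abs_le.1 (h τ hτ)).1]
  · refine fiberSum_mono fun τ hτ => ?_
    nlinarith [hW τ, (abs_le.1 (h τ hτ)).2]

/-- Tilting a two-point distribution with masses proportional to `a` and `b` by a field `c`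
moves the mean by at most `|1 - exp c| / (1 + exp c)` times the difference of the values. -/
theorem abs_tilt_sub_le {a b : ℝ} (ha : 0 < a) (hb : 0 < b) (x y c : ℝ) :
    |(Real.exp c * (a * x) + Real.exp (-c) * (b * y)) / (Real.exp c * a + Real.exp (-c) * b) -
      (a * x + b * y) / (a + b)| ≤ |1 - Real.exp c| / (1 + Real.exp c) * |x - y| := by
  obtain ⟨q, hq⟩ : ∃ q, q = Real.exp c := ⟨_, rfl⟩
  have hq0 : 0 < q := hq ▸ Real.exp_pos c
  rw [Real.exp_neg, ← hq]
  have hD : 0 < q * a + q⁻¹ * b := by positivity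
  have e : (q * (a * x) + q⁻¹ * (b * y)) / (q * a + q⁻¹ * b) - (a * x + b * y) / (a + b) =
      ((q - 1) / (1 + q)) * (a * b * (1 + q) ^ 2 / ((q ^ 2 * a + b) * (a + b))) * (x - y) := by
    have : q ^ 2 * a + b ≠ 0 := by positivity
    field_simp
    ring
  rw [e, abs_mul, abs_mul]
  refine mul_le_mul_of_nonneg_right ?_ (abs_nonneg _)
  have h1 : |(q - 1) / (1 + q)| = |1 - q| / (1 + q) := by
    rw [abs_div, abs_sub_comm, abs_of_pos (by positivity : 0 < 1 + q)]
  rw [h1]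
  refine mul_le_of_le_one_right (by positivity) ?_
  rw [abs_of_nonneg (by positivity), div_le_one (by positivity)]
  -- By the inequality of arithmetic and geometric means, as `2 q a b ≤ (q a) ^ 2 + b ^ 2`.
  nlinarith [sq_nonneg (q * a - b)]

/-! ### Influence of a boundary spin through a block -/

/-- The Gibbs weight with an additional external field `k`. -/
def fieldWeight (G : SimpleGraph V) (J : Sym2 V → ℝ) (β : ℝ) (k : V → ℝ) (τ : V → ℤˣ) : ℝ :=
  Real.exp (β * interaction G J τ + ∑ x, k x * ((τ x : ℤ) : ℝ))

theorem fieldWeight_pos (G : SimpleGraph V) (J : Sym2 V → ℝ) (β : ℝ) (k : V → ℝ) (τ : V → ℤˣ) :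
    0 < fieldWeight G J β k τ := Real.exp_pos _

open Classical in
/-- The influence `Γ` of the pair `u, v`: that of the edge between them, or `0` if there is none. -/
def edgeInfluence (G : SimpleGraph V) (J : Sym2 V → ℝ) (β : ℝ) (u v : V) : ℝ :=
  if G.Adj u v then influence J β s(u, v) else 0

open Classical in
/-- The field that a spin `+1` at `u` exerts on `v`, relative to a spin `-1` at `u`. -/
def edgeField (G : SimpleGraph V) (J : Sym2 V → ℝ) (β : ℝ) (u v : V) : ℝ :=
  if G.Adj u v then β * J s(u, v) else 0

omit [Fintype V] [DecidableEq V] in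
theorem edgeInfluence_eq (G : SimpleGraph V) (J : Sym2 V → ℝ) (β : ℝ) (u v : V) :
    edgeInfluence G J β u v =
      |1 - Real.exp (edgeField G J β u v)| / (1 + Real.exp (edgeField G J β u v)) := by
  unfold edgeInfluence edgeField influence
  split_ifs <;> simp

theorem interaction_update_sub (G : SimpleGraph V) (J : Sym2 V → ℝ) (τ : V → ℤˣ) (u : V) (β : ℝ) :
    β * interaction G J (update τ u 1) - β * interaction G J (update τ u (-1)) =
      ∑ v, edgeField G J β u v * ((τ v : ℤ) : ℝ) := by
  classical
  rw [interaction, interaction, Finset.mul_sum, Finset.mul_sum, ← Finset.sum_sub_distrib]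
  symm
  have e1 : ∑ v, edgeField G J β u v * ((τ v : ℤ) : ℝ) =
      ∑ v ∈ G.neighborFinset u, β * J s(u, v) * ((τ v : ℤ) : ℝ) := by
    rw [← Finset.sum_subset (Finset.subset_univ (G.neighborFinset u))]
    · refine Finset.sum_congr rfl fun v hv => ?_
      rw [edgeField, if_pos ((G.mem_neighborFinset u v).1 hv)]
    · intro v _ hv
      rw [edgeField, if_neg (fun h => hv ((G.mem_neighborFinset u v).2 h)), zero_mul]
  have hinj : Set.InjOn (fun v => s(u, v)) (G.neighborFinset u : Set V) := by
    intro v _ v' _ h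
    exact Sym2.congr_right.1 h
  have hsub : (G.neighborFinset u).image (fun v => s(u, v)) ⊆ G.edgeFinset := by
    intro e he
    obtain ⟨v, hv, rfl⟩ := Finset.mem_image.1 he
    simpa using hv
  rw [e1, ← Finset.sum_subset hsub, Finset.sum_image hinj]
  · refine Finset.sum_congr rfl fun v hv => ?_
    have hne : v ≠ u := fun h => by simp [h] at hv
    have key : ∀ s : ℤˣ, (∀ x ∈ s(u, v), ∀ y ∈ s(u, v), update τ u s x = update τ u s y) ↔
        s = τ v := by
      intro s
      constructor
      · intro h
        simpa [hne] using h u (by simp) v (by simp)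
      · intro h x hx y hy
        rcases Sym2.mem_iff.1 hx with rfl | rfl <;> rcases Sym2.mem_iff.1 hy with rfl | rfl <;>
          simp [hne, h]
    simp only [key]
    rcases Int.units_eq_one_or (τ v) with h | h <;> simp [h]
  · intro e he hu
    have hue : u ∉ e := by
      intro hue
      obtain ⟨v, rfl⟩ := hue
      exact hu (Finset.mem_image.2 ⟨v, by simpa using he, rfl⟩)
    have key : ∀ s : ℤˣ, (∀ x ∈ e, ∀ y ∈ e, update τ u s x = update τ u s y) ↔
        (∀ x ∈ e, ∀ y ∈ e, τ x = τ y) := by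
      intro s
      refine forall₂_congr fun x hx => forall₂_congr fun y hy => ?_
      rw [update_of_ne (fun h : x = u => hue (h ▸ hx)), update_of_ne (fun h : y = u => hue (h ▸ hy))]
    simp only [key, sub_self]

/-- Up to a constant factor, a spin `+1` at `u` acts like a spin `-1` with an additional field on the
neighbours. -/
theorem fieldWeight_update (G : SimpleGraph V) (J : Sym2 V → ℝ) (β : ℝ) (k : V → ℝ)
    (τ : V → ℤˣ) (u : V) :
    fieldWeight G J β k (update τ u 1) = Real.exp (2 * k u) *
      fieldWeight G J β (k + edgeField G J β u) (update τ u (-1)) := by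
  classical
  have h0 : edgeField G J β u u = 0 := by simp [edgeField]
  have hs : ∀ (c : V → ℝ) (s : ℤˣ), ∑ x, c x * ((update τ u s x : ℤ) : ℝ) =
      c u * ((s : ℤ) : ℝ) + ∑ x ∈ Finset.univ.erase u, c x * ((τ x : ℤ) : ℝ) := by
    intro c s
    rw [← Finset.add_sum_erase _ _ (Finset.mem_univ u)]
    congr 1
    · simp
    · refine Finset.sum_congr rfl fun x hx => ?_
      rw [update_of_ne (Finset.ne_of_mem_erase hx)]
  have hs' : ∑ v, edgeField G J β u v * ((τ v : ℤ) : ℝ) =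
      ∑ x ∈ Finset.univ.erase u, edgeField G J β u x * ((τ x : ℤ) : ℝ) := by
    rw [← Finset.add_sum_erase _ _ (Finset.mem_univ u), h0]; simp
  have hI := interaction_update_sub G J τ u β
  rw [fieldWeight, fieldWeight, ← Real.exp_add, hs, hs]
  rw [hs'] at hI
  congr 1
  simp only [Pi.add_apply, h0, add_mul, Finset.sum_add_distrib]
  push_cast [Units.val_neg, Units.val_one]
  linarith

theorem fieldWeight_add_single (G : SimpleGraph V) (J : Sym2 V → ℝ) (β : ℝ) (k : V → ℝ)
    (v : V) (c : ℝ) (τ : V → ℤˣ) :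
    fieldWeight G J β (k + Pi.single v c) τ =
      Real.exp (c * ((τ v : ℤ) : ℝ)) * fieldWeight G J β k τ := by
  classical
  rw [fieldWeight, fieldWeight, ← Real.exp_add]
  congr 1
  simp only [Pi.add_apply, add_mul, Finset.sum_add_distrib]
  have e : ∑ x, (Pi.single v c : V → ℝ) x * ((τ x : ℤ) : ℝ) = c * ((τ v : ℤ) : ℝ) := by
    rw [Finset.sum_eq_single_of_mem v (Finset.mem_univ v) (fun x _ hx => by simp [hx]),
      Pi.single_eq_same]
  rw [e]
  ring

theorem condMean_congr_weight {B : Finset V} {σ : V → ℤˣ} {W W' : (V → ℤˣ) → ℝ} {c : ℝ}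
    (hc : c ≠ 0) (h : ∀ τ, (∀ v, v ∉ B → τ v = σ v) → W' τ = c * W τ) (f : (V → ℤˣ) → ℝ) :
    condMean W' B f σ = condMean W B f σ := by
  rw [condMean, condMean, fiberSum_congr (φ := W') (ψ := fun τ => c * W τ) h,
    fiberSum_congr (φ := fun τ => W' τ * f τ) (ψ := fun τ => c * (W τ * f τ))
      (fun τ hτ => by rw [h τ hτ, mul_assoc]), fiberSum_mul_left, fiberSum_mul_left,
    mul_div_mul_left _ _ hc]

/-- Changing the external field at a single vertex `v ∈ B`. -/
theorem abs_condMean_add_single_sub_le (G : SimpleGraph V) (J : Sym2 V → ℝ) (β : ℝ) (k : V → ℝ)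
    {B : Finset V} {v : V} (hv : v ∈ B) (c : ℝ) (f : (V → ℤˣ) → ℝ) (σ : V → ℤˣ) :
    |condMean (fieldWeight G J β (k + Pi.single v c)) B f σ -
        condMean (fieldWeight G J β k) B f σ| ≤
      |1 - Real.exp c| / (1 + Real.exp c) *
        |condMean (fieldWeight G J β k) (B.erase v) f (update σ v 1) -
          condMean (fieldWeight G J β k) (B.erase v) f (update σ v (-1))| := by
  set W := fieldWeight G J β k with hWdef
  have hW : ∀ τ, 0 < W τ := fieldWeight_pos G J β k
  have hv' : v ∉ B.erase v := by simp
  have ha := fiberSum_pos (B := B.erase v) (σ := update σ v 1) hW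
  have hb := fiberSum_pos (B := B.erase v) (σ := update σ v (-1)) hW
  have h1 : ∀ φ : (V → ℤˣ) → ℝ, fiberSum (B.erase v) (update σ v 1)
      (fun τ => Real.exp (c * ((τ v : ℤ) : ℝ)) * φ τ) =
        Real.exp c * fiberSum (B.erase v) (update σ v 1) φ := by
    intro φ
    rw [← fiberSum_mul_left]
    refine fiberSum_congr fun τ hτ => ?_
    have := hτ v hv'
    simp only [update_self] at this
    simp [this]
  have h2 : ∀ φ : (V → ℤˣ) → ℝ, fiberSum (B.erase v) (update σ v (-1))
      (fun τ => Real.exp (c * ((τ v : ℤ) : ℝ)) * φ τ) =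
        Real.exp (-c) * fiberSum (B.erase v) (update σ v (-1)) φ := by
    intro φ
    rw [← fiberSum_mul_left]
    refine fiberSum_congr fun τ hτ => ?_
    have := hτ v hv'
    simp only [update_self] at this
    simp [this]
  have key := abs_tilt_sub_le ha hb (condMean W (B.erase v) f (update σ v 1))
    (condMean W (B.erase v) f (update σ v (-1))) c
  have hF : ∀ s : ℤˣ, 0 < fiberSum (B.erase v) (update σ v s) W →
      fiberSum (B.erase v) (update σ v s) W * condMean W (B.erase v) f (update σ v s) =
      fiberSum (B.erase v) (update σ v s) (fun τ => W τ * f τ) := by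
    intro s hs
    rw [condMean, mul_div_cancel₀ _ hs.ne']
  rw [hF 1 ha, hF (-1) hb] at key
  refine le_trans (le_of_eq ?_) key
  have hW' : fieldWeight G J β (k + Pi.single v c) =
      fun τ => Real.exp (c * ((τ v : ℤ) : ℝ)) * W τ := by
    funext τ
    exact fieldWeight_add_single G J β k v c τ
  rw [hW']
  simp only [condMean]
  rw [fiberSum_split hv σ, fiberSum_split hv σ, fiberSum_split hv σ, fiberSum_split hv σ]
  simp only [mul_assoc]
  rw [h1, h2, h1, h2]

/-- The weighted number of self-avoiding paths of length at most `K` that start at `u` and stay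
in `B` afterwards: a path counts with the product of `Γ` along its edges times `w` at its end. The
bound `K` makes the recursion structural; it is no restriction once `K` is at least the size
of `B`. -/
def pathSum (Γ : V → V → ℝ) (w : V → ℝ) : ℕ → Finset V → V → ℝ
  | 0, _, u => w u
  | K + 1, B, u => w u + ∑ v ∈ B, Γ u v * pathSum Γ w K (B.erase v) v

omit [Fintype V] [DecidableEq V] in
theorem edgeInfluence_nonneg (G : SimpleGraph V) (J : Sym2 V → ℝ) (β : ℝ) (u v : V) :
    0 ≤ edgeInfluence G J β u v := by
  rw [edgeInfluence_eq]; positivity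

/-- Changing the external field at all vertices of `B`, one vertex at a time. -/
theorem abs_condMean_field_sub_le (G : SimpleGraph V) (J : Sym2 V → ℝ) (β : ℝ) (k c : V → ℝ)
    {B : Finset V} (f : (V → ℤˣ) → ℝ) (σ : V → ℤˣ) (D : V → ℝ)
    (hD : ∀ k : V → ℝ, ∀ v ∈ B,
      |condMean (fieldWeight G J β k) (B.erase v) f (update σ v 1) -
          condMean (fieldWeight G J β k) (B.erase v) f (update σ v (-1))| ≤ D v) :
    |condMean (fieldWeight G J β (k + c)) B f σ - condMean (fieldWeight G J β k) B f σ| ≤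
      ∑ v ∈ B, |1 - Real.exp (c v)| / (1 + Real.exp (c v)) * D v := by
  classical
  have hin : ∀ S ⊆ B, |condMean (fieldWeight G J β (k + ∑ v ∈ S, Pi.single v (c v))) B f σ -
      condMean (fieldWeight G J β k) B f σ| ≤
      ∑ v ∈ S, |1 - Real.exp (c v)| / (1 + Real.exp (c v)) * D v := by
    intro S
    induction S using Finset.induction_on with
    | empty => simp
    | insert v S hv ih =>
      intro hS
      rw [Finset.insert_subset_iff] at hS
      rw [Finset.sum_insert hv, Finset.sum_insert hv, add_comm (Pi.single v (c v) : V → ℝ),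
        ← add_assoc]
      refine (abs_sub_le _ (condMean (fieldWeight G J β (k + ∑ v ∈ S, Pi.single v (c v))) B f σ)
        _).trans (add_le_add ?_ (ih hS.2))
      refine (abs_condMean_add_single_sub_le G J β _ hS.1 (c v) f σ).trans ?_
      exact mul_le_mul_of_nonneg_left (hD _ v hS.1) (by positivity)
  have hout : condMean (fieldWeight G J β (k + c)) B f σ =
      condMean (fieldWeight G J β (k + ∑ v ∈ B, Pi.single v (c v))) B f σ := by
    refine condMean_congr_weight
      (c := Real.exp (∑ x ∈ Bᶜ, c x * ((σ x : ℤ) : ℝ))) (Real.exp_pos _).ne' (fun τ hτ => ?_) f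
    rw [fieldWeight, fieldWeight, ← Real.exp_add]
    congr 1
    have e1 : ∀ x, (∑ v ∈ B, Pi.single v (c v) : V → ℝ) x = if x ∈ B then c x else 0 := by
      intro x
      simp [Finset.sum_apply, Pi.single_apply]
    have e2 : ∑ x, c x * ((τ x : ℤ) : ℝ) = ∑ x ∈ Bᶜ, c x * ((σ x : ℤ) : ℝ) +
        ∑ x, (∑ v ∈ B, Pi.single v (c v) : V → ℝ) x * ((τ x : ℤ) : ℝ) := by
      simp only [e1, ite_mul, zero_mul]
      rw [← Finset.sum_filter, Finset.filter_mem_eq_inter, Finset.univ_inter,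
        ← Finset.sum_compl_add_sum B]
      congr 1
      refine Finset.sum_congr rfl fun x hx => ?_
      rw [hτ x (Finset.mem_compl.1 hx)]
    simp only [Pi.add_apply, add_mul, Finset.sum_add_distrib]
    rw [e2]
    ring
  rw [hout]
  exact hin B le_rfl

/-- A flip of a boundary spin `u` changes the conditional mean of `f` on `B` by at most the sum over
the self-avoiding paths from `u` through `B`. The flip is a change of the fields at the neighbours
of `u`; a changed field at `v` is in turn a random flip of `v`, now a boundary spin of `B \ {v}`. -/
theorem abs_condMean_update_sub_le (G : SimpleGraph V) (J : Sym2 V → ℝ) (β : ℝ)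
    {f : (V → ℤˣ) → ℝ} {g : V → ℝ}
    (hf : ∀ u σ, |f (update σ u 1) - f (update σ u (-1))| ≤ g u) (K : ℕ) :
    ∀ (B : Finset V), B.card ≤ K → ∀ (k : V → ℝ) (σ : V → ℤˣ), ∀ u ∉ B,
    |condMean (fieldWeight G J β k) B f (update σ u 1) -
        condMean (fieldWeight G J β k) B f (update σ u (-1))| ≤
      pathSum (edgeInfluence G J β) g K B u := by
  have step : ∀ (B : Finset V) (D : V → ℝ), (∀ (k : V → ℝ) (σ : V → ℤˣ), ∀ v ∈ B,
      |condMean (fieldWeight G J β k) (B.erase v) f (update σ v 1) -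
          condMean (fieldWeight G J β k) (B.erase v) f (update σ v (-1))| ≤ D v) →
      ∀ (k : V → ℝ) (σ : V → ℤˣ), ∀ u ∉ B,
      |condMean (fieldWeight G J β k) B f (update σ u 1) -
        condMean (fieldWeight G J β k) B f (update σ u (-1))| ≤
      g u + ∑ v ∈ B, edgeInfluence G J β u v * D v := by
    intro B D hD k σ u hu
    have e : condMean (fieldWeight G J β k) B f (update σ u 1) =
        condMean (fieldWeight G J β (k + edgeField G J β u)) B (fun τ => f (update τ u 1))
          (update σ u (-1)) := by
      have h1 : condMean (fieldWeight G J β k) B f (update σ u 1) =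
          condMean (fun τ => fieldWeight G J β k (update τ u 1)) B (fun τ => f (update τ u 1))
          (update σ u (-1)) := by
        rw [condMean, condMean, fiberSum_update hu σ _ 1 (-1), fiberSum_update hu σ _ 1 (-1)]
      rw [h1]
      refine condMean_congr_weight (Real.exp_pos (2 * k u)).ne' (fun τ hτ => ?_) _
      rw [fieldWeight_update]
      congr 2
      have := hτ u hu
      simp only [update_self] at this
      rw [← this, update_eq_self]
    rw [e]
    refine (abs_sub_le _ (condMean (fieldWeight G J β (k + edgeField G J β u)) B f
      (update σ u (-1))) _).trans (add_le_add ?_ ?_)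
    · refine abs_condMean_sub_le (fieldWeight_pos G J β _) fun τ hτ => ?_
      have := hτ u hu
      simp only [update_self] at this
      have h2 := hf u τ
      rwa [← this, update_eq_self] at h2
    · simp only [edgeInfluence_eq]
      exact abs_condMean_field_sub_le G J β k (edgeField G J β u) f _ D
        (fun k v hv => hD k _ v hv)
  induction K with
  | zero =>
    intro B hB k σ u hu
    have hB' : B = ∅ := by simpa using hB
    subst hB'
    simpa [pathSum] using step ∅ (fun _ => 0) (by simp) k σ u hu
  | succ K ih =>
    intro B hB k σ u hu
    refine step B (fun v => pathSum (edgeInfluence G J β) g K (B.erase v) v) ?_ k σ u hu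
    intro k σ v hv
    refine ih (B.erase v) ?_ k σ v (by simp)
    rw [Finset.card_erase_of_mem hv]
    omega

end Fibers

/-! ### Self-avoiding paths as lists -/

section Lists

variable {V : Type*} [DecidableEq V]

open Classical in
/-- The self-avoiding paths of `G` that start at `u`, have length at most `K` and stay in `B` after
the first vertex. A path is encoded by the list of its vertices without `u`. -/
def sawLists (G : SimpleGraph V) : ℕ → Finset V → V → Finset (List V)
  | 0, _, _ => {[]}
  | K + 1, B, u =>
    insert [] ((B.filter (G.Adj u)).biUnion fun v => (sawLists G K (B.erase v) v).image (List.cons v))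

theorem mem_sawLists {G : SimpleGraph V} {K : ℕ} {B : Finset V} {u : V} {l : List V} :
    l ∈ sawLists G K B u ↔
      l.length ≤ K ∧ (u :: l).IsChain G.Adj ∧ l.Nodup ∧ ∀ x ∈ l, x ∈ B := by
  induction K generalizing B u l with
  | zero =>
    simp only [sawLists, Finset.mem_singleton, Nat.le_zero, List.length_eq_zero_iff]
    constructor
    · rintro rfl; simp
    · exact fun h => h.1
  | succ K ih =>
    cases l with
    | nil => simp [sawLists]
    | cons v l =>
      simp only [sawLists, Finset.mem_insert, reduceCtorEq, false_or, Finset.mem_biUnion,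
        Finset.mem_filter, Finset.mem_image, List.cons.injEq, List.length_cons, add_le_add_iff_right,
        List.isChain_cons_cons, List.nodup_cons, List.mem_cons, forall_eq_or_imp]
      constructor
      · rintro ⟨v', ⟨hB, hadj⟩, l', hl', rfl, rfl⟩
        obtain ⟨h1, h2, h3, h4⟩ := ih.1 hl'
        exact ⟨h1, ⟨hadj, h2⟩, ⟨fun hv => by simpa using h4 _ hv, h3⟩, hB,
          fun x hx => Finset.mem_of_mem_erase (h4 x hx)⟩
      · rintro ⟨h1, ⟨hadj, h2⟩, ⟨hv, h3⟩, hB, h4⟩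
        exact ⟨v, ⟨hB, hadj⟩, l, ih.2 ⟨h1, h2, h3, fun x hx => Finset.mem_erase.2
          ⟨fun e => hv (e ▸ hx), h4 x hx⟩⟩, rfl, rfl⟩

omit [DecidableEq V] in
theorem getLastD_mem {B : Finset V} {y : V} (hy : y ∈ B) {l : List V} (hl : ∀ x ∈ l, x ∈ B) :
    l.getLastD y ∈ B := by
  rcases List.eq_nil_or_concat l with rfl | ⟨l', a, rfl⟩
  · simpa using hy
  · simpa using hl a (by simp)

omit [DecidableEq V] in
theorem isChain_append_singleton {G : SimpleGraph V} {l : List V} {y z : V} (hc : (y :: l).IsChain G.Adj)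
    (h : G.Adj (l.getLastD y) z) : (y :: (l ++ [z])).IsChain G.Adj := by
  induction l generalizing y with
  | nil => simpa using h
  | cons x l ih =>
    rw [List.getLastD_cons] at h
    rw [List.isChain_cons_cons] at hc
    exact List.isChain_cons_cons.2 ⟨hc.1, ih hc.2 h⟩

/-- The product of `Γ` along the edges of the path `u :: l`. -/
def pathProd (Γ : V → V → ℝ) : V → List V → ℝ
  | _, [] => 1
  | u, v :: l => Γ u v * pathProd Γ v l

theorem pathSum_eq_sum_sawLists {G : SimpleGraph V} {Γ : V → V → ℝ}
    (hΓ : ∀ u v, ¬ G.Adj u v → Γ u v = 0) (w : V → ℝ) (K : ℕ) (B : Finset V) (u : V) :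
    pathSum Γ w K B u = ∑ l ∈ sawLists G K B u, pathProd Γ u l * w (l.getLastD u) := by
  classical
  induction K generalizing B u with
  | zero => simp [pathSum, sawLists, pathProd]
  | succ K ih =>
    rw [pathSum, sawLists, Finset.sum_insert (by simp), Finset.sum_biUnion]
    · simp only [pathProd, List.getLastD_nil, one_mul]
      congr 1
      rw [Finset.sum_filter]
      refine Finset.sum_congr rfl fun v _ => ?_
      split_ifs with h
      · rw [Finset.sum_image (fun _ _ _ _ h => (List.cons.inj h).2), ih, Finset.mul_sum]
        refine Finset.sum_congr rfl fun l _ => ?_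
        rw [pathProd, List.getLastD_cons, mul_assoc]
      · rw [hΓ u v h, zero_mul]
    · intro v _ v' _ hne
      refine Finset.disjoint_left.2 fun l hl hl' => hne ?_
      obtain ⟨l1, _, rfl⟩ := Finset.mem_image.1 hl
      obtain ⟨l2, _, h2⟩ := Finset.mem_image.1 hl'
      exact (List.cons.inj h2).1.symm

omit [DecidableEq V] in
theorem pathProd_nonneg {Γ : V → V → ℝ} (h0 : ∀ u v, 0 ≤ Γ u v) (u : V) (l : List V) :
    0 ≤ pathProd Γ u l := by
  induction l generalizing u with
  | nil => simp [pathProd]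
  | cons v l ih => exact mul_nonneg (h0 u v) (ih v)

omit [DecidableEq V] in
theorem pathProd_le_one {Γ : V → V → ℝ} (h0 : ∀ u v, 0 ≤ Γ u v) (h1 : ∀ u v, Γ u v ≤ 1)
    (u : V) (l : List V) : pathProd Γ u l ≤ 1 := by
  induction l generalizing u with
  | nil => simp [pathProd]
  | cons v l ih => exact mul_le_one₀ (h1 u v) (pathProd_nonneg h0 v l) (ih v)

omit [DecidableEq V] in
theorem pathProd_append (Γ : V → V → ℝ) (u : V) (l l' : List V) :
    pathProd Γ u (l ++ l') = pathProd Γ u l * pathProd Γ (l.getLastD u) l' := by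
  induction l generalizing u with
  | nil => simp [pathProd]
  | cons v l ih => rw [List.cons_append, pathProd, pathProd, ih, List.getLastD_cons, mul_assoc]

omit [DecidableEq V] in
/-- The edges of a path that enter and leave an inner vertex `x` have influences of sum at most
`A x`, hence of product at most `(A x / 2) ^ 2`. -/
theorem pathProd_append_singleton_le {Γ : V → V → ℝ} {A : V → ℝ} (h0 : ∀ u v, 0 ≤ Γ u v)
    (h1 : ∀ u v, Γ u v ≤ 1) (hA : ∀ a x b, a ≠ b → Γ a x + Γ x b ≤ A x) {a b : V} {l : List V}
    (hl : (a :: (l ++ [b])).Nodup) :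
    pathProd Γ a (l ++ [b]) ≤ (l.map fun x => A x / 2).prod := by
  have hA0 : ∀ l : List V, (∀ x ∈ l, 0 ≤ A x / 2) → 0 ≤ (l.map fun x => A x / 2).prod := by
    intro l h
    refine List.prod_nonneg fun y hy => ?_
    obtain ⟨x, hx, rfl⟩ := List.mem_map.1 hy
    exact h x hx
  -- The induction needs the square and the influence of the first edge.
  have key : ∀ (l : List V) (a : V), (a :: (l ++ [b])).Nodup →
      (∀ x ∈ l, 0 ≤ A x / 2) ∧
      pathProd Γ a (l ++ [b]) ^ 2 ≤
        Γ a ((l ++ [b]).headD b) * ((l.map fun x => A x / 2).prod) ^ 2 := by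
    intro l
    induction l with
    | nil =>
      intro a _
      simp only [List.nil_append, pathProd, List.headD_cons, List.map_nil, List.prod_nil]
      refine ⟨by simp, ?_⟩
      nlinarith [h0 a b, h1 a b]
    | cons x l ih =>
      intro a hl
      rw [List.cons_append, List.nodup_cons] at hl
      obtain ⟨ih0, ih⟩ := ih x hl.2
      set h := (l ++ [b]).headD b with hh
      have hmem : h ∈ l ++ [b] := by
        cases l <;> simp [hh]
      have hne : a ≠ h := fun e => hl.1 (List.mem_cons_of_mem _ (e ▸ hmem))
      have hAx := hA a x h hne
      have ha := h0 a x
      have hb := h0 x h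
      have hx0 : 0 ≤ A x / 2 := by linarith
      refine ⟨?_, ?_⟩
      · intro y hy
        rcases List.mem_cons.1 hy with rfl | hy
        exacts [hx0, ih0 y hy]
      · rw [List.cons_append, pathProd, List.headD_cons, List.map_cons, List.prod_cons, mul_pow,
          mul_pow]
        set Q := ((l.map fun x => A x / 2).prod) ^ 2
        have hQ : 0 ≤ Q := sq_nonneg _
        have h2 : Γ a x * Γ x h ≤ (A x / 2) ^ 2 := by
          nlinarith [sq_nonneg (Γ a x - Γ x h)]
        calc Γ a x ^ 2 * pathProd Γ x (l ++ [b]) ^ 2 ≤ Γ a x ^ 2 * (Γ x h * Q) :=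
              mul_le_mul_of_nonneg_left ih (sq_nonneg _)
          _ = Γ a x * (Γ a x * Γ x h) * Q := by ring
          _ ≤ Γ a x * (A x / 2) ^ 2 * Q := by gcongr
          _ = _ := by ring
  obtain ⟨k0, k⟩ := key l a hl
  refine abs_le_of_sq_le_sq' (k.trans ?_) (hA0 l k0) |>.2
  exact mul_le_of_le_one_left (sq_nonneg _) (h1 _ _)

/-- A Kraft inequality for exits: if every path has product of `A` at most `C` at the moment
of leaving, the total influence of the exits is at most `C`. Here `w x` is the influence that
leaves through `x`. -/
theorem pathSum_le {Γ : V → V → ℝ} {A w : V → ℝ} (h0 : ∀ u v, 0 ≤ Γ u v) (hw0 : ∀ x, 0 ≤ w x)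
    {G : SimpleGraph V} (hΓ : ∀ u v, ¬ G.Adj u v → Γ u v = 0)
    (K : ℕ) (B : Finset V) (u : V) (C : ℝ) (hC : 0 ≤ C)
    (hA : ∀ x ∈ insert u B, ∀ S ⊆ B, w x + ∑ v ∈ S, Γ x v ≤ A x)
    (h : ∀ l ∈ sawLists G K B u, 0 < w (l.getLastD u) → ((u :: l).map A).prod ≤ C) :
    pathSum Γ w K B u ≤ C := by
  classical
  induction K generalizing B u C with
  | zero =>
    rw [pathSum]
    rcases (hw0 u).eq_or_lt with e | hpos
    · rw [← e]; exact hC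
    · have := h [] (by simp [sawLists]) (by simpa using hpos)
      have h2 := hA u (by simp) ∅ (by simp)
      simp at this h2
      linarith
  | succ K ih =>
    rw [pathSum]
    have hAu := hA u (by simp) B le_rfl
    have hsum0 : 0 ≤ ∑ v ∈ B, Γ u v := Finset.sum_nonneg fun v _ => h0 u v
    have hAu0 : 0 ≤ A u := by linarith [hw0 u]
    rcases hAu0.eq_or_lt with hz | hpos
    · have hw : w u = 0 := by linarith [hw0 u]
      have hs : ∑ v ∈ B, Γ u v = 0 := by linarith [hw0 u]
      rw [Finset.sum_eq_zero_iff_of_nonneg (fun v _ => h0 u v)] at hs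
      rw [hw, Finset.sum_eq_zero (fun v hv => by rw [hs v hv, zero_mul])]
      simpa using hC
    · have hstep : ∀ v ∈ B, Γ u v * pathSum Γ w K (B.erase v) v ≤ Γ u v * (C / A u) := by
        intro v hv
        by_cases hadj : G.Adj u v
        · refine mul_le_mul_of_nonneg_left ?_ (h0 u v)
          refine ih (B.erase v) v (C / A u) (by positivity) ?_ ?_
          · intro x hx S hS
            refine hA x ?_ S (hS.trans (Finset.erase_subset _ _))
            rcases Finset.mem_insert.1 hx with rfl | hx
            · exact Finset.mem_insert_of_mem hv
            · exact Finset.mem_insert_of_mem (Finset.mem_of_mem_erase hx)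
          · intro l hl hwl
            rw [le_div_iff₀ hpos, mul_comm]
            obtain ⟨a1, a2, a3, a4⟩ := mem_sawLists.1 hl
            have := h (v :: l) (mem_sawLists.2 ⟨by simpa using a1,
              List.isChain_cons_cons.2 ⟨hadj, a2⟩,
              List.nodup_cons.2 ⟨fun hvl => by simpa using a4 v hvl, a3⟩, ?_⟩)
              (by rwa [List.getLastD_cons])
            · simpa using this
            · intro x hx
              rcases List.mem_cons.1 hx with rfl | hx
              exacts [hv, Finset.mem_of_mem_erase (a4 x hx)]
        · simp [hΓ u v hadj]
      have hwu : w u ≤ w u * (C / A u) := by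
        rcases (hw0 u).eq_or_lt with e | hwpos
        · simp [← e]
        · have := h [] (mem_sawLists.2 (by simp)) (by simpa using hwpos)
          simp at this
          exact le_mul_of_one_le_right (hw0 u) ((one_le_div hpos).2 this)
      calc w u + ∑ v ∈ B, Γ u v * pathSum Γ w K (B.erase v) v
          ≤ w u * (C / A u) + ∑ v ∈ B, Γ u v * (C / A u) :=
            add_le_add hwu (Finset.sum_le_sum hstep)
        _ = (w u + ∑ v ∈ B, Γ u v) * (C / A u) := by rw [← Finset.sum_mul, add_mul]
        _ ≤ A u * (C / A u) := mul_le_mul_of_nonneg_right hAu (by positivity)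
        _ = C := by field_simp

/-! ### Counting paths in a tree with an extra edge -/

omit [DecidableEq V] in
theorem eq_of_isChain_of_isAcyclic {T : SimpleGraph V} (hT : T.IsAcyclic) {p q : List V}
    (hp : p.IsChain T.Adj) (hq : q.IsChain T.Adj) (hpn : p.Nodup) (hqn : q.Nodup)
    (hh : p.head? = q.head?) (hl : p.getLast? = q.getLast?) : p = q := by
  by_cases hp0 : p = []
  · subst hp0
    simpa [eq_comm] using hh
  by_cases hq0 : q = []
  · subst hq0
    simpa using hh
  have h1 : q.head hq0 = p.head hp0 := by
    rw [List.head?_eq_some_head hp0, List.head?_eq_some_head hq0] at hh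
    exact (Option.some.inj hh).symm
  have h2 : q.getLast hq0 = p.getLast hp0 := by
    rw [List.getLast?_eq_some_getLast hp0, List.getLast?_eq_some_getLast hq0] at hl
    exact (Option.some.inj hl).symm
  have hP : (SimpleGraph.Walk.ofSupport p hp0 hp).IsPath :=
    SimpleGraph.Walk.IsPath.mk' (by rwa [SimpleGraph.Walk.support_ofSupport])
  have hQ : ((SimpleGraph.Walk.ofSupport q hq0 hq).copy h1 h2).IsPath :=
    SimpleGraph.Walk.IsPath.mk' (by
      rwa [SimpleGraph.Walk.support_copy, SimpleGraph.Walk.support_ofSupport])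
  have := congrArg (fun r => r.1.support) ((hT.subsingleton_path _ _).elim ⟨_, hP⟩ ⟨_, hQ⟩)
  simpa using this

/-- In a tree with at most one extra edge there are at most three self-avoiding paths between two
vertices: one that avoids the extra edge, and one for each direction in which it is crossed. -/
theorem card_sawLists_getLastD_le {G : SimpleGraph V} {B : Finset V}
    (hB : IsTreePlusAtMostOneEdge (G.induce (B : Set V))) {y : V} (hy : y ∈ B) (K : ℕ) (x : V) :
    ((sawLists G K (B.erase y) y).filter fun l => l.getLastD y = x).card ≤ 3 := by
  classical
  obtain ⟨T, hTle, hT, hsub⟩ := hB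
  -- Adjacency in the spanning tree of the block, read on all of `V`.
  let R : V → V → Prop := fun a b => ∃ (ha : a ∈ (B : Set V)) (hb : b ∈ (B : Set V)),
    T.Adj ⟨a, ha⟩ ⟨b, hb⟩
  have hlift : ∀ p : List V, (∀ a ∈ p, a ∈ B) → ∃ q : List (B : Set V), q.map Subtype.val = p := by
    intro p hp
    exact ⟨p.attachWith _ hp, by simp⟩
  have huniq : ∀ p q : List V, (∀ a ∈ p, a ∈ B) → (∀ a ∈ q, a ∈ B) → p.IsChain R → q.IsChain R →
      p.Nodup → q.Nodup → p.head? = q.head? → p.getLast? = q.getLast? → p = q := by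
    intro p q hp hq hpc hqc hpn hqn hh hl
    obtain ⟨p, rfl⟩ := hlift p hp
    obtain ⟨q, rfl⟩ := hlift q hq
    rw [List.isChain_map] at hpc hqc
    congr 1
    refine eq_of_isChain_of_isAcyclic hT.isAcyclic (hpc.imp ?_) (hqc.imp ?_) (hpn.of_map _)
      (hqn.of_map _) ?_ ?_
    · rintro a b ⟨_, _, h⟩; exact h
    · rintro a b ⟨_, _, h⟩; exact h
    · rw [List.head?_map, List.head?_map] at hh
      exact Option.map_injective Subtype.val_injective hh
    · rw [List.getLast?_map, List.getLast?_map] at hl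
      exact Option.map_injective Subtype.val_injective hl
  have hextra : ∀ a b a' b' : V, a ∈ B → b ∈ B → a' ∈ B → b' ∈ B → G.Adj a b → G.Adj a' b' →
      ¬ R a b → ¬ R a' b' → s(a, b) = s(a', b') := by
    intro a b a' b' ha hb ha' hb' h h' hR hR'
    have e : (s(⟨a, ha⟩, ⟨b, hb⟩) : Sym2 (B : Set V)) = s(⟨a', ha'⟩, ⟨b', hb'⟩) := by
      refine hsub ⟨?_, ?_⟩ ⟨?_, ?_⟩
      · simpa using h
      · intro hh; exact hR ⟨ha, hb, by simpa using hh⟩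
      · simpa using h'
      · intro hh; exact hR' ⟨ha', hb', by simpa using hh⟩
    simpa using congrArg (Sym2.map Subtype.val) e
  set F := (sawLists G K (B.erase y) y).filter fun l => l.getLastD y = x with hF
  have hFmem : ∀ l ∈ F, (y :: l).IsChain G.Adj ∧ (y :: l).Nodup ∧ (∀ a ∈ y :: l, a ∈ B) ∧
      (y :: l).getLast? = some x := by
    intro l hl
    rw [hF, Finset.mem_filter, mem_sawLists] at hl
    obtain ⟨⟨_, h2, h3, h4⟩, h5⟩ := hl
    refine ⟨h2, List.nodup_cons.2 ⟨fun h => by simpa using h4 y h, h3⟩, ?_, ?_⟩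
    · intro a ha
      rcases List.mem_cons.1 ha with rfl | ha
      exacts [hy, Finset.mem_of_mem_erase (h4 a ha)]
    · rw [← h5, List.getLast?_cons, List.getLastD_eq_getLast?]
  have hsplit : ∀ p : List V, p.IsChain G.Adj → ¬ p.IsChain R →
      ∃ a b q r, p = q ++ a :: b :: r ∧ G.Adj a b ∧ ¬ R a b := by
    intro p hp hn
    rw [List.isChain_iff_forall_rel_of_append_cons_cons] at hp hn
    push Not at hn
    obtain ⟨a, b, q, r, e, h⟩ := hn
    exact ⟨a, b, q, r, e, hp e, h⟩
  -- Around the extra edge both halves of the path run in the tree.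
  have hhalves : ∀ (q r : List V) (a b : V), (q ++ a :: b :: r).IsChain G.Adj →
      (q ++ a :: b :: r).Nodup → (∀ c ∈ q ++ a :: b :: r, c ∈ B) → ¬ R a b →
      (q ++ [a]).IsChain R ∧ (b :: r).IsChain R := by
    intro q r a b hc hn hm hR
    obtain ⟨c1, c2, c3⟩ := List.isChain_append_cons_cons.1 hc
    have ha : a ∈ B := hm a (by simp)
    have hb : b ∈ B := hm b (by simp)
    constructor
    · by_contra hcon
      obtain ⟨a', b', q', r', e, h, hR'⟩ := hsplit _ c1 hcon
      have hm' : ∀ c ∈ q ++ [a], c ∈ B := fun c hc => hm c (by simp at hc ⊢; tauto)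
      have := hextra a b a' b' ha hb (hm' a' (by rw [e]; simp)) (hm' b' (by rw [e]; simp)) c2 h
        hR hR'
      have hbm : b ∈ q ++ [a] := by
        have h3 : b ∈ s(a', b') := this ▸ Sym2.mem_mk_right a b
        rw [e]
        rcases Sym2.mem_iff.1 h3 with rfl | rfl <;> simp
      have hn' : ((q ++ [a]) ++ (b :: r)).Nodup := by simpa using hn
      exact (List.nodup_append.1 hn').2.2 b hbm b (by simp) rfl
    · by_contra hcon
      obtain ⟨a', b', q', r', e, h, hR'⟩ := hsplit _ c3 hcon
      have hm' : ∀ c ∈ b :: r, c ∈ B := fun c hc => hm c (by simp at hc ⊢; tauto)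
      have := hextra a b a' b' ha hb (hm' a' (by rw [e]; simp)) (hm' b' (by rw [e]; simp)) c2 h
        hR hR'
      have ham : a ∈ b :: r := by
        have h3 : a ∈ s(a', b') := this ▸ Sym2.mem_mk_left a b
        rw [e]
        rcases Sym2.mem_iff.1 h3 with rfl | rfl <;> simp
      have hn' : ((q ++ [a]) ++ (b :: r)).Nodup := by simpa using hn
      exact (List.nodup_append.1 hn').2.2 a (by simp) a ham rfl
  -- The paths that cross the edge from `a` to `b` in this direction.
  let P : V → V → List V → Prop := fun a b l => ∃ q r, y :: l = q ++ a :: b :: r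
  have hP1 : ∀ a b, ¬ R a b → (F.filter (P a b)).card ≤ 1 := by
    intro a b hR
    rw [Finset.card_le_one]
    intro l hl l' hl'
    obtain ⟨hl, q, r, e⟩ := Finset.mem_filter.1 hl
    obtain ⟨hl', q', r', e'⟩ := Finset.mem_filter.1 hl'
    obtain ⟨f1, f2, f3, f4⟩ := hFmem l hl
    obtain ⟨f1', f2', f3', f4'⟩ := hFmem l' hl'
    have hd : (y :: l).head? = (y :: l').head? := by simp
    rw [e] at f1 f2 f3 f4 hd
    rw [e'] at f1' f2' f3' f4' hd
    obtain ⟨t1, t2⟩ := hhalves q r a b f1 f2 f3 hR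
    obtain ⟨t1', t2'⟩ := hhalves q' r' a b f1' f2' f3' hR
    have n1 : ((q ++ [a]) ++ (b :: r)).Nodup := by simpa using f2
    have n1' : ((q' ++ [a]) ++ (b :: r')).Nodup := by simpa using f2'
    have E1 : q ++ [a] = q' ++ [a] := by
      refine huniq _ _ (fun c hc => f3 c (by simp at hc ⊢; tauto))
        (fun c hc => f3' c (by simp at hc ⊢; tauto)) t1 t1' (List.nodup_append.1 n1).1
        (List.nodup_append.1 n1').1 ?_ (by simp)
      cases q <;> cases q' <;> first | (simp; done) | simpa using hd
    have E2 : b :: r = b :: r' := by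
      refine huniq _ _ (fun c hc => f3 c (by simp at hc ⊢; tauto))
        (fun c hc => f3' c (by simp at hc ⊢; tauto)) t2 t2' (List.nodup_append.1 n1).2.1
        (List.nodup_append.1 n1').2.1 (by simp) ?_
      have g : (q ++ a :: b :: r).getLast? = (q' ++ a :: b :: r').getLast? := by rw [f4, f4']
      simpa [List.getLast?_append, List.getLast?_cons] using g
    have E : y :: l = y :: l' := by
      rw [e, e', List.append_cancel_right E1, E2]
    exact (List.cons.inj E).2
  have hP0 : (F.filter fun l => (y :: l).IsChain R).card ≤ 1 := by
    rw [Finset.card_le_one]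
    intro l hl l' hl'
    obtain ⟨hl, c⟩ := Finset.mem_filter.1 hl
    obtain ⟨hl', c'⟩ := Finset.mem_filter.1 hl'
    obtain ⟨f1, f2, f3, f4⟩ := hFmem l hl
    obtain ⟨f1', f2', f3', f4'⟩ := hFmem l' hl'
    exact (List.cons.inj (huniq _ _ f3 f3' c c' f2 f2' (by simp) (by rw [f4, f4']))).2
  by_cases hall : ∀ l ∈ F, (y :: l).IsChain R
  · rw [Finset.filter_true_of_mem hall] at hP0
    omega
  · push Not at hall
    obtain ⟨l0, hl0, hn0⟩ := hall
    obtain ⟨g1, g2, g3, _⟩ := hFmem l0 hl0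
    obtain ⟨a, b, q, r, e, hab, hR⟩ := hsplit _ g1 hn0
    have ha : a ∈ B := g3 a (by rw [e]; simp)
    have hb : b ∈ B := g3 b (by rw [e]; simp)
    have hR' : ¬ R b a := by
      rintro ⟨h1, h2, h3⟩
      exact hR ⟨h2, h1, h3.symm⟩
    have hcov : F ⊆ (F.filter fun l => (y :: l).IsChain R) ∪
        (F.filter (P a b) ∪ F.filter (P b a)) := by
      intro l hl
      obtain ⟨f1, f2, f3, _⟩ := hFmem l hl
      simp only [Finset.mem_union, Finset.mem_filter, hl, true_and]
      by_cases hc : (y :: l).IsChain R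
      · exact Or.inl hc
      · right
        obtain ⟨a', b', q', r', e', hab', hRab'⟩ := hsplit _ f1 hc
        have ha' : a' ∈ B := f3 a' (by rw [e']; simp)
        have hb' : b' ∈ B := f3 b' (by rw [e']; simp)
        have := hextra a b a' b' ha hb ha' hb' hab hab' hR hRab'
        rcases Sym2.eq_iff.1 this with ⟨rfl, rfl⟩ | ⟨rfl, rfl⟩
        · exact Or.inl ⟨q', r', e'⟩
        · exact Or.inr ⟨q', r', e'⟩
    have := Finset.card_le_card hcov
    have h1 := Finset.card_union_le (F.filter fun l => (y :: l).IsChain R)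
        (F.filter (P a b) ∪ F.filter (P b a))
    have h2 := Finset.card_union_le (F.filter (P a b)) (F.filter (P b a))
    have h3 := hP1 a b hR
    have h4 := hP1 b a hR'
    omega

end Lists

/-! ### Influences, weights and block vertices -/

section Influences

variable {V : Type*} [Fintype V] [DecidableEq V] {G : SimpleGraph V} {J : Sym2 V → ℝ} {β : ℝ}

omit [Fintype V] [DecidableEq V] in
theorem edgeInfluence_le_one (u v : V) : edgeInfluence G J β u v ≤ 1 := by
  rw [edgeInfluence_eq, div_le_one (by positivity), abs_le]
  constructor <;> linarith [Real.exp_pos (edgeField G J β u v)]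

omit [Fintype V] [DecidableEq V] in
theorem edgeInfluence_comm (u v : V) : edgeInfluence G J β u v = edgeInfluence G J β v u := by
  rw [edgeInfluence, edgeInfluence, Sym2.eq_swap]
  by_cases h : G.Adj u v
  · rw [if_pos h, if_pos h.symm]
  · rw [if_neg h, if_neg fun h' => h h'.symm]

omit [Fintype V] [DecidableEq V] in
theorem edgeInfluence_of_not_adj (u v : V) (h : ¬ G.Adj u v) : edgeInfluence G J β u v = 0 := by
  rw [edgeInfluence, if_neg h]

omit [DecidableEq V] in
theorem aggInfluence_eq_sum (u : V) :
    aggInfluence G J β u = ∑ v, edgeInfluence G J β u v := by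
  classical
  rw [aggInfluence, ← Finset.sum_subset (Finset.subset_univ (G.neighborFinset u))]
  · refine Finset.sum_congr rfl fun v hv => ?_
    rw [edgeInfluence, if_pos ((G.mem_neighborFinset u v).1 hv)]
  · intro v _ hv
    rw [edgeInfluence, if_neg (fun h => hv ((G.mem_neighborFinset u v).2 h))]

omit [DecidableEq V] in
theorem sum_edgeInfluence_le (u : V) (S : Finset V) :
    ∑ v ∈ S, edgeInfluence G J β u v ≤ aggInfluence G J β u := by
  rw [aggInfluence_eq_sum]
  exact Finset.sum_le_sum_of_subset_of_nonneg (Finset.subset_univ S)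
    fun v _ _ => edgeInfluence_nonneg G J β u v

omit [DecidableEq V] in
theorem aggInfluence_nonneg (u : V) : 0 ≤ aggInfluence G J β u := by
  simpa using sum_edgeInfluence_le (G := G) (J := J) (β := β) u ∅

theorem edgeInfluence_add_le (a x b : V) (h : a ≠ b) :
    edgeInfluence G J β a x + edgeInfluence G J β x b ≤ aggInfluence G J β x := by
  have := sum_edgeInfluence_le (G := G) (J := J) (β := β) x {a, b}
  rwa [Finset.sum_pair h, edgeInfluence_comm x a] at this

variable {d ε : ℝ}

/-- The factor by which the aggregate influence of a vertex is smaller than its weight. -/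
def gap (ε : ℝ) : ℝ := (1 - ε / 2) / (1 - ε / 4)

theorem gap_pos (hε1 : ε < 1) : 0 < gap ε := div_pos (by linarith) (by linarith)

theorem gap_lt_one (hε : 0 < ε) (hε1 : ε < 1) : gap ε < 1 := by
  rw [gap, div_lt_one] <;> linarith

omit [DecidableEq V] in
theorem le_vertexWeight (hε : 0 < ε) (hε1 : ε < 1) (hd : 2 ≤ d) (u : V) :
    1 - ε / 4 ≤ vertexWeight G J β d ε u := by
  rw [vertexWeight]
  split_ifs with h
  · exact le_rfl
  · nlinarith

omit [DecidableEq V] in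
theorem aggInfluence_le_gap_mul (hε : 0 < ε) (hε1 : ε < 1) (hd : 2 ≤ d) (u : V) :
    aggInfluence G J β u ≤ gap ε * vertexWeight G J β d ε u := by
  rw [vertexWeight]
  split_ifs with h
  · rw [gap, div_mul_cancel₀ _ (by linarith)]
    exact h
  · have h1 : 1 / 2 ≤ gap ε := by rw [gap, div_le_div_iff₀] <;> linarith
    have h2 := aggInfluence_nonneg (G := G) (J := J) (β := β) u
    have h3 : 1 ≤ gap ε * d := by nlinarith
    nlinarith

omit [DecidableEq V] in
theorem prod_aggInfluence_le (hε : 0 < ε) (hε1 : ε < 1) (hd : 2 ≤ d) (l : List V) :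
    (l.map (aggInfluence G J β)).prod ≤
      gap ε ^ l.length * (l.map (vertexWeight G J β d ε)).prod := by
  induction l with
  | nil => simp
  | cons x l ih =>
    simp only [List.map_cons, List.prod_cons, List.length_cons]
    have h0 : 0 ≤ (l.map (aggInfluence G J β)).prod := List.prod_nonneg (by
      simpa using fun x _ => aggInfluence_nonneg x)
    have hM := le_vertexWeight (G := G) (J := J) (β := β) hε hε1 hd x
    calc _ ≤ (gap ε * vertexWeight G J β d ε x) *
          (gap ε ^ l.length * (l.map (vertexWeight G J β d ε)).prod) :=
        mul_le_mul (aggInfluence_le_gap_mul hε hε1 hd x) ih h0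
          (mul_nonneg (gap_pos hε1).le (by linarith))
      _ = _ := by ring

omit [DecidableEq V] in
theorem prod_vertexWeight_pos (hε : 0 < ε) (hε1 : ε < 1) (hd : 2 ≤ d) (l : List V) :
    0 < (l.map (vertexWeight G J β d ε)).prod := by
  refine List.prod_pos ?_
  intro y hy
  obtain ⟨x, _, rfl⟩ := List.mem_map.1 hy
  have := le_vertexWeight (G := G) (J := J) (β := β) hε hε1 hd x
  linarith

omit [DecidableEq V] in
theorem IsBlockVertex.prod_lt_one {u : V} (hu : IsBlockVertex G J β d ε u) {l : List V}
    (hc : (u :: l).IsChain G.Adj) (hn : (u :: l).Nodup)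
    (hl : (l.length : ℝ) ≤ Real.log (Fintype.card V)) :
    vertexWeight G J β d ε u * (l.map (vertexWeight G J β d ε)).prod < 1 := by
  obtain ⟨x, p, hp⟩ : ∃ (x : V) (p : G.Walk u x), p.support = u :: l :=
    ⟨_, SimpleGraph.Walk.ofSupport (u :: l) (by simp) hc, SimpleGraph.Walk.support_ofSupport _ _⟩
  have hlen : p.length = l.length := by
    have := p.length_support
    rw [hp] at this
    simpa using this.symm
  have := hu x p (SimpleGraph.Walk.IsPath.mk' (by rwa [hp])) (by rwa [hlen])
  rw [pathWeight, hp] at this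
  simpa using this

omit [DecidableEq V] in
theorem IsBlockVertex.aggInfluence_le (hε1 : ε < 1) (hd : 2 ≤ d) {u : V}
    (hu : IsBlockVertex G J β d ε u) : aggInfluence G J β u ≤ 1 - ε / 2 := by
  have := hu.prod_lt_one (l := []) (by simp) (by simp) (by simpa using Real.log_natCast_nonneg _)
  by_contra hcon
  rw [vertexWeight, if_neg hcon] at this
  simp at this
  nlinarith

omit [DecidableEq V] in
theorem IsBlockVertex.vertexWeight_eq (hε1 : ε < 1) (hd : 2 ≤ d) {u : V}
    (hu : IsBlockVertex G J β d ε u) : vertexWeight G J β d ε u = 1 - ε / 4 := by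
  rw [vertexWeight, if_pos (hu.aggInfluence_le hε1 hd)]

open Classical in
/-- An upper bound for the total influence that leaves the block of `v` when a spin disagrees at `v`:
`1` for block vertices. At other vertices the bound comes from a block vertex next to `v`, whose own
weight `1 - ε / 4` has to be divided out of the weight of the paths. -/
def exitBound (G : SimpleGraph V) (J : Sym2 V → ℝ) (β d ε : ℝ) (v : V) : ℝ :=
  if IsBlockVertex G J β d ε v then 1 else 1 / (1 - ε / 4)

omit [DecidableEq V] in
theorem one_le_exitBound (hε : 0 < ε) (hε1 : ε < 1) (v : V) : 1 ≤ exitBound G J β d ε v := by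
  rw [exitBound]
  split_ifs
  · exact le_rfl
  · rw [le_div_iff₀] <;> linarith

omit [DecidableEq V] in
theorem exitBound_le (hε : 0 < ε) (hε1 : ε < 1) (v : V) :
    exitBound G J β d ε v ≤ 1 / (1 - ε / 4) := by
  rw [exitBound]
  split_ifs
  · rw [le_div_iff₀] <;> linarith
  · exact le_rfl

omit [DecidableEq V] in
/-- Paths that start at a vertex `y` with a neighbouring block vertex `u` off the path. -/
theorem prod_vertexWeight_le_exitBound (hε : 0 < ε) (hε1 : ε < 1) (hd : 2 ≤ d) {u y : V}
    (hu : IsBlockVertex G J β d ε u) (hadj : G.Adj u y) {l : List V}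
    (hc : (y :: l).IsChain G.Adj) (hn : (u :: y :: l).Nodup)
    (hl : (l.length : ℝ) + 1 ≤ Real.log (Fintype.card V)) :
    ((y :: l).map (vertexWeight G J β d ε)).prod ≤ exitBound G J β d ε y := by
  rw [exitBound]
  split_ifs with hy
  · rw [List.map_cons, List.prod_cons]
    exact (hy.prod_lt_one hc (List.nodup_cons.1 hn).2 (by linarith)).le
  · rw [le_div_iff₀ (by linarith), mul_comm, ← hu.vertexWeight_eq hε1 hd]
    exact (hu.prod_lt_one (List.isChain_cons_cons.2 ⟨hadj, hc⟩) hn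
      (by simpa using hl)).le

omit [DecidableEq V] in
/-- Paths that end next to a block vertex `z`. -/
theorem prod_vertexWeight_le_of_end (hε1 : ε < 1) (hd : 2 ≤ d) {z : V}
    (hz : IsBlockVertex G J β d ε z) {l : List V} (hc : (l ++ [z]).IsChain G.Adj)
    (hn : (l ++ [z]).Nodup) (hl : (l.length : ℝ) ≤ Real.log (Fintype.card V)) :
    (l.map (vertexWeight G J β d ε)).prod ≤ 1 / (1 - ε / 4) := by
  have hc' : (z :: l.reverse).IsChain G.Adj := by
    have := List.isChain_reverse.2 (hc.imp fun _ _ h => h.symm)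
    simpa using this
  have hn' : (z :: l.reverse).Nodup := by
    have := List.nodup_reverse.2 hn
    simpa using this
  have := hz.prod_lt_one hc' hn' (by simpa using hl)
  rw [List.map_reverse, List.prod_reverse, hz.vertexWeight_eq hε1 hd] at this
  rw [le_div_iff₀ (by linarith), mul_comm]
  exact this.le

/-! ### Total influence on the exits of a block -/

open Classical in
/-- The influence of `x` on the complement of `B`. -/
def exitInfluence (G : SimpleGraph V) (J : Sym2 V → ℝ) (β : ℝ) (B : Finset V) (x : V) : ℝ :=
  ∑ z ∈ Bᶜ, edgeInfluence G J β x z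

theorem exitInfluence_nonneg (B : Finset V) (x : V) : 0 ≤ exitInfluence G J β B x :=
  Finset.sum_nonneg fun z _ => edgeInfluence_nonneg G J β x z

theorem card_sawLists_le {B : Finset V}
    (hB : IsTreePlusAtMostOneEdge (G.induce (B : Set V))) {y : V} (hy : y ∈ B) (K : ℕ) :
    (sawLists G K (B.erase y) y).card ≤ 3 * Fintype.card V := by
  rw [Finset.card_eq_sum_card_fiberwise (f := fun l => l.getLastD y) (t := Finset.univ)
    (fun _ _ => Finset.mem_univ _), mul_comm, ← smul_eq_mul, ← Finset.card_univ]
  exact Finset.sum_le_card_nsmul _ _ _ fun x _ => card_sawLists_getLastD_le hB hy K x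

/-- The exits that are reached by a path of length less than `2 k`: the first `k` and the last `k`
vertices cover the path, so the weights control the product of the aggregate influences on it. -/
theorem pathSum_exitInfluence_short_le (hε : 0 < ε) (hε1 : ε < 1) (hd : 2 ≤ d) {B : Finset V}
    (hbd : ∀ w ∈ outerBoundary G B, IsBlockVertex G J β d ε w) {u y : V} (hy : y ∈ B)
    (hu : u ∉ B) (hadj : G.Adj u y) {k : ℕ} (hk1 : 1 ≤ k)
    (hk : (k : ℝ) ≤ Real.log (Fintype.card V)) (hgap : gap ε ^ (k - 1) * (1 / (1 - ε / 4)) ≤ 1) :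
    pathSum (edgeInfluence G J β) (exitInfluence G J β B) (2 * k - 1) (B.erase y) y ≤
      gap ε * exitBound G J β d ε y := by
  have hg0 := gap_pos hε1
  have hg1 := gap_lt_one hε hε1
  have hh := one_le_exitBound (G := G) (J := J) (β := β) (d := d) hε hε1 y
  have hub : IsBlockVertex G J β d ε u := hbd u ⟨hu, y, hy, hadj⟩
  refine pathSum_le (A := aggInfluence G J β) (edgeInfluence_nonneg G J β)
    (exitInfluence_nonneg B) (G := G) edgeInfluence_of_not_adj _ _ _ _
    (mul_nonneg hg0.le (by linarith)) ?_ ?_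
  · intro x _ S hS
    have hdisj : Disjoint Bᶜ S := by
      rw [Finset.disjoint_left]
      intro a ha haS
      exact Finset.mem_compl.1 ha (Finset.mem_of_mem_erase (hS haS))
    rw [exitInfluence, ← Finset.sum_union hdisj]
    exact sum_edgeInfluence_le x _
  · intro l hl hpos
    obtain ⟨hlen, hc, hn, hmem⟩ := mem_sawLists.1 hl
    have hyl : y ∉ l := fun h => by simpa using hmem y h
    have hlB : ∀ x ∈ l, x ∈ B := fun x hx => Finset.mem_of_mem_erase (hmem x hx)
    have hul : u ∉ y :: l := by
      intro h
      rcases List.mem_cons.1 h with rfl | h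
      exacts [hu hy, hu (hlB u h)]
    have hnod : (u :: y :: l).Nodup := List.nodup_cons.2 ⟨hul, List.nodup_cons.2 ⟨hyl, hn⟩⟩
    refine (prod_aggInfluence_le hε hε1 hd (y :: l)).trans ?_
    by_cases hcase : l.length + 1 ≤ k
    · have h1 := prod_vertexWeight_le_exitBound hε hε1 hd hub hadj hc hnod
        (le_trans (by exact_mod_cast hcase) hk)
      refine mul_le_mul ?_ h1 (prod_vertexWeight_pos hε hε1 hd _).le hg0.le
      exact pow_le_of_le_one hg0.le hg1.le (by simp)
    · push Not at hcase
      obtain ⟨z, hz, hzpos⟩ := Finset.exists_ne_zero_of_sum_ne_zero hpos.ne'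
      have hzadj : G.Adj (l.getLastD y) z := by
        by_contra hcon
        exact hzpos (edgeInfluence_of_not_adj _ _ hcon)
      have hzB : z ∉ B := Finset.mem_compl.1 hz
      have hlast := getLastD_mem hy hlB
      have hzb : IsBlockVertex G J β d ε z := hbd z ⟨hzB, _, hlast, hzadj.symm⟩
      have hzl : z ∉ l := fun h => hzB (hlB z h)
      have hcz : (l ++ [z]).IsChain G.Adj := (isChain_append_singleton hc hzadj).tail
      have hnz : (l ++ [z]).Nodup := by
        rw [List.nodup_append]
        refine ⟨hn, by simp, ?_⟩
        intro a ha b hb e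
        simp at hb
        exact hzl (hb ▸ e ▸ ha)
      -- The first `k` vertices are controlled from `u`, the others from the exit `z`.
      have hsplit : l = l.take (k - 1) ++ l.drop (k - 1) := (List.take_append_drop _ _).symm
      have hinit := prod_vertexWeight_le_exitBound hε hε1 hd hub hadj (l := l.take (k - 1))
        (by
          have : y :: l.take (k - 1) <+: y :: l := by
            simpa using List.take_prefix (k - 1) l
          exact hc.prefix this)
        (hnod.sublist (by simpa using (List.take_sublist (k - 1) l)))
        (le_trans (by
          have : (l.take (k - 1)).length + 1 ≤ k := by rw [List.length_take]; omega
          exact_mod_cast this) hk)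
      have hfin := prod_vertexWeight_le_of_end hε1 hd hzb (l := l.drop (k - 1))
        (by
          refine hcz.suffix ?_
          conv_rhs => rw [hsplit]
          rw [List.append_assoc]
          exact List.suffix_append _ _)
        (hnz.sublist (List.Sublist.append (List.drop_sublist _ _) (List.Sublist.refl _)))
        (le_trans (by
          have : (l.drop (k - 1)).length ≤ k := by rw [List.length_drop]; omega
          exact_mod_cast this) hk)
      have hprod : ((y :: l).map (vertexWeight G J β d ε)).prod =
          ((y :: l.take (k - 1)).map (vertexWeight G J β d ε)).prod *
            ((l.drop (k - 1)).map (vertexWeight G J β d ε)).prod := by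
        conv_lhs => rw [hsplit]
        simp only [List.map_cons, List.map_append, List.prod_cons, List.prod_append, mul_assoc]
      have hpow : gap ε ^ (y :: l).length ≤ gap ε * gap ε ^ (k - 1) := by
        rw [← pow_succ']
        exact pow_le_pow_of_le_one hg0.le hg1.le (by simp; omega)
      have hp1 := (prod_vertexWeight_pos (G := G) (J := J) (β := β) hε hε1 hd (l.drop (k - 1))).le
      have hp2 := (prod_vertexWeight_pos (G := G) (J := J) (β := β) hε hε1 hd (y :: l)).le
      have hpk : 0 ≤ gap ε ^ (k - 1) := pow_nonneg hg0.le _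
      calc gap ε ^ (y :: l).length * ((y :: l).map (vertexWeight G J β d ε)).prod
          ≤ gap ε * gap ε ^ (k - 1) * (exitBound G J β d ε y * (1 / (1 - ε / 4))) := by
            refine mul_le_mul hpow ?_ hp2 (mul_nonneg hg0.le hpk)
            rw [hprod]
            exact mul_le_mul hinit hfin hp1 (by linarith)
        _ = gap ε * exitBound G J β d ε y * (gap ε ^ (k - 1) * (1 / (1 - ε / 4))) := by ring
        _ ≤ gap ε * exitBound G J β d ε y :=
            mul_le_of_le_one_right (mul_nonneg hg0.le (by linarith)) hgap

/-- A path with at least `2 k` edges before its last one. Every vertex gains a factor `1 / 2`, and the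
weights control the influences at `k - 1` vertices near the start and at the last `k` vertices; these
two parts of the path have no edge in common. -/
theorem pathProd_long_le (hε : 0 < ε) (hε1 : ε < 1) (hd : 2 ≤ d) {u y z : V}
    (hub : IsBlockVertex G J β d ε u) (hzb : IsBlockVertex G J β d ε z) (hadj : G.Adj u y)
    {l : List V} (hc : (y :: (l ++ [z])).IsChain G.Adj) (hn : (y :: (l ++ [z])).Nodup)
    (hul : u ∉ y :: l) {k : ℕ} (hk1 : 1 ≤ k)
    (hk : (k : ℝ) ≤ Real.log (Fintype.card V)) (hlen : 2 * k ≤ l.length) :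
    pathProd (edgeInfluence G J β) y (l ++ [z]) ≤ 8 / 4 ^ k := by
  have hg0 := gap_pos hε1
  have hg1 := gap_lt_one hε hε1
  have h43 : 1 / (1 - ε / 4) ≤ 4 / 3 := by rw [div_le_div_iff₀] <;> linarith
  obtain ⟨l1, m, l3, rfl, hl1, hl3, hm⟩ : ∃ l1 m l3 : List V, l = l1 ++ (m ++ l3) ∧
      l1.length = k - 1 ∧ l3.length = k ∧ m ≠ [] := by
    refine ⟨l.take (k - 1), (l.drop (k - 1)).take (l.length - (k - 1) - k),
      (l.drop (k - 1)).drop (l.length - (k - 1) - k), ?_, ?_, ?_, ?_⟩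
    · rw [List.take_append_drop, List.take_append_drop]
    · rw [List.length_take]; omega
    · rw [List.length_drop, List.length_drop]; omega
    · intro h
      have := congrArg List.length h
      rw [List.length_take, List.length_drop, List.length_nil] at this
      omega
  obtain ⟨c, m', rfl⟩ := List.exists_cons_of_ne_nil hm
  set c' := m'.getLastD c with hc'
  obtain ⟨m'', hm''⟩ : ∃ m'', c :: m' = m'' ++ [c'] := by
    rcases List.eq_nil_or_concat m' with rfl | ⟨q, a, rfl⟩
    · exact ⟨[], by simp [hc']⟩
    · exact ⟨c :: q, by simp [hc']⟩
  have hhalf : ∀ (a b : V) (q : List V), (a :: (q ++ [b])).Nodup →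
      (q.map (vertexWeight G J β d ε)).prod ≤ 2 →
      pathProd (edgeInfluence G J β) a (q ++ [b]) ≤ 2 / 2 ^ q.length := by
    intro a b q hq hM
    refine (pathProd_append_singleton_le (edgeInfluence_nonneg G J β) edgeInfluence_le_one
      edgeInfluence_add_le hq).trans ?_
    have e : (q.map fun x => aggInfluence G J β x / 2).prod =
        (q.map (aggInfluence G J β)).prod / 2 ^ q.length := by
      clear hq hM
      induction q with
      | nil => simp
      | cons x q ih => simp only [List.map_cons, List.prod_cons, List.length_cons, ih]; ring
    rw [e]
    refine div_le_div_of_nonneg_right ?_ (by positivity)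
    refine (prod_aggInfluence_le hε hε1 hd q).trans (le_trans ?_ hM)
    exact mul_le_of_le_one_left (prod_vertexWeight_pos hε hε1 hd q).le (pow_le_one₀ hg0.le hg1.le)
  have e1 : pathProd (edgeInfluence G J β) y (l1 ++ (c :: m' ++ l3) ++ [z]) =
      pathProd (edgeInfluence G J β) y (l1 ++ [c]) * (pathProd (edgeInfluence G J β) c m' *
        pathProd (edgeInfluence G J β) c' (l3 ++ [z])) := by
    rw [hc', ← pathProd_append]
    have : l1 ++ (c :: m' ++ l3) ++ [z] = (l1 ++ [c]) ++ (m' ++ (l3 ++ [z])) := by simp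
    rw [this, pathProd_append]
    congr 2
    simp
  have hn2 : (c' :: (l3 ++ [z])).Nodup := by
    refine hn.sublist (List.Sublist.trans ?_ (List.sublist_cons_self _ _))
    rw [hm'']
    have : l1 ++ (m'' ++ [c'] ++ l3) ++ [z] = (l1 ++ m'') ++ (c' :: (l3 ++ [z])) := by simp
    rw [this]
    exact List.sublist_append_right _ _
  have hM1 : (l1.map (vertexWeight G J β d ε)).prod ≤ 2 := by
    have h1 := prod_vertexWeight_le_exitBound hε hε1 hd hub hadj (l := l1)
      (hc.prefix (by simp)) (List.nodup_cons.2 ⟨fun h => hul (by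
        simp at h ⊢; tauto), hn.sublist (by simp)⟩)
      (le_trans (by
        have : l1.length + 1 ≤ k := by omega
        exact_mod_cast this) hk)
    have h2 := exitBound_le (G := G) (J := J) (β := β) (d := d) hε hε1 y
    have h3 := le_vertexWeight (G := G) (J := J) (β := β) hε hε1 hd y
    have h4 := prod_vertexWeight_pos (G := G) (J := J) (β := β) hε hε1 hd l1
    rw [List.map_cons, List.prod_cons] at h1
    nlinarith
  have hM3 : (l3.map (vertexWeight G J β d ε)).prod ≤ 2 := by
    have h1 := prod_vertexWeight_le_of_end hε1 hd hzb (l := l3)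
      (hc.suffix (by
        have : y :: (l1 ++ (c :: m' ++ l3) ++ [z]) = (y :: (l1 ++ (c :: m'))) ++ (l3 ++ [z]) := by
          simp
        rw [this]
        exact List.suffix_append _ _))
      (List.nodup_cons.1 hn2).2
      (le_trans (by exact_mod_cast hl3.le) hk)
    linarith
  have b1 := hhalf y c l1 (hn.sublist (by simp)) hM1
  have b3 := hhalf c' z l3 hn2 hM3
  rw [hl1] at b1
  rw [hl3] at b3
  have p0 := pathProd_nonneg (edgeInfluence_nonneg G J β)
  have p1 := pathProd_le_one (edgeInfluence_nonneg G J β) edgeInfluence_le_one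
  rw [e1]
  calc _ ≤ (2 : ℝ) / 2 ^ (k - 1) * (1 * (2 / 2 ^ k)) := by
        refine mul_le_mul b1 (mul_le_mul (p1 _ _) b3 (p0 _ _) zero_le_one)
          (mul_nonneg (p0 _ _) (p0 _ _)) (by positivity)
    _ = 8 / 4 ^ k := by
        obtain ⟨j, rfl⟩ : ∃ j, k = j + 1 := ⟨k - 1, by omega⟩
        have : (4 : ℝ) ^ (j + 1) = 2 ^ (j + 1) * 2 ^ (j + 1) := by rw [← mul_pow]; norm_num
        rw [this, Nat.add_sub_cancel]
        field_simp
        ring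

end Influences

section Contraction

variable {V : Type*} [Fintype V] [DecidableEq V] {G : SimpleGraph V} {J : Sym2 V → ℝ} {β : ℝ}
  {d ε : ℝ}

/-- The exits that are reached by a path of length at least `2 k`: there are at most three paths
to each of them. -/
theorem sum_exitInfluence_long_le (hε : 0 < ε) (hε1 : ε < 1) (hd : 2 ≤ d) {B : Finset V}
    (hB : IsTreePlusAtMostOneEdge (G.induce (B : Set V)))
    (hbd : ∀ w ∈ outerBoundary G B, IsBlockVertex G J β d ε w)
    (huniq : ∀ w ∈ outerBoundary G B, ∃! v, v ∈ B ∧ G.Adj w v) {u y : V} (hy : y ∈ B)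
    (hu : u ∉ B) (hadj : G.Adj u y) {k : ℕ} (hk1 : 1 ≤ k)
    (hk : (k : ℝ) ≤ Real.log (Fintype.card V)) (K : ℕ) :
    ∑ l ∈ (sawLists G K (B.erase y) y).filter (fun l => ¬ l.length ≤ 2 * k - 1),
      pathProd (edgeInfluence G J β) y l * exitInfluence G J β B (l.getLastD y) ≤
      Fintype.card V * (24 / 4 ^ k) := by
  set F := (sawLists G K (B.erase y) y).filter (fun l => ¬ l.length ≤ 2 * k - 1) with hF
  have hub : IsBlockVertex G J β d ε u := hbd u ⟨hu, y, hy, hadj⟩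
  have h8 : (0 : ℝ) ≤ 8 / 4 ^ k := by positivity
  simp only [exitInfluence, Finset.mul_sum]
  rw [Finset.sum_comm]
  have hz : ∀ z ∈ Bᶜ, ∑ l ∈ F, pathProd (edgeInfluence G J β) y l *
      edgeInfluence G J β (l.getLastD y) z ≤ 24 / 4 ^ k := by
    intro z hzB
    rw [Finset.mem_compl] at hzB
    by_cases hzo : z ∈ outerBoundary G B
    · obtain ⟨x, ⟨hxB, hzx⟩, hx⟩ := huniq z hzo
      have hle : ∀ l ∈ F, pathProd (edgeInfluence G J β) y l *
          edgeInfluence G J β (l.getLastD y) z ≤ if l.getLastD y = x then 8 / 4 ^ k else 0 := by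
        intro l hl
        obtain ⟨hl, hlen⟩ := Finset.mem_filter.1 hl
        obtain ⟨_, hc, hn, hmem⟩ := mem_sawLists.1 hl
        have hlB : ∀ x ∈ l, x ∈ B := fun x hx => Finset.mem_of_mem_erase (hmem x hx)
        have hlast := getLastD_mem hy hlB
        by_cases hadjz : G.Adj (l.getLastD y) z
        · have e : pathProd (edgeInfluence G J β) y l * edgeInfluence G J β (l.getLastD y) z =
              pathProd (edgeInfluence G J β) y (l ++ [z]) := by
            rw [pathProd_append, pathProd, pathProd, mul_one]
          rw [if_pos (hx _ ⟨hlast, hadjz.symm⟩), e]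
          refine pathProd_long_le hε hε1 hd hub (hbd z hzo) hadj
            (isChain_append_singleton hc hadjz) ?_ ?_ hk1 hk (by omega)
          · rw [List.nodup_cons, List.nodup_append]
            refine ⟨?_, hn, by simp, ?_⟩
            · intro h
              rcases List.mem_append.1 h with h | h
              · simpa using hmem y h
              · exact hzB (by simpa [← List.mem_singleton.1 h] using hy)
            · intro a ha b hb e
              rw [List.mem_singleton.1 hb] at e
              exact hzB (e ▸ hlB a ha)
          · intro h
            rcases List.mem_cons.1 h with rfl | h
            exacts [hu hy, hu (hlB u h)]
        · rw [edgeInfluence_of_not_adj _ _ hadjz, mul_zero]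
          split_ifs
          exacts [h8, le_rfl]
      refine (Finset.sum_le_sum hle).trans ?_
      rw [← Finset.sum_filter, Finset.sum_const, nsmul_eq_mul]
      have hcard : (F.filter fun l => l.getLastD y = x).card ≤ 3 :=
        (Finset.card_le_card (Finset.filter_subset_filter _ (Finset.filter_subset _ _))).trans
          (card_sawLists_getLastD_le hB hy K x)
      have hcard' : ((F.filter fun l => l.getLastD y = x).card : ℝ) ≤ 3 := by exact_mod_cast hcard
      calc _ ≤ (3 : ℝ) * (8 / 4 ^ k) := mul_le_mul_of_nonneg_right hcard' h8
        _ = _ := by ring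
    · rw [Finset.sum_eq_zero]
      · positivity
      · intro l hl
        obtain ⟨hl, _⟩ := Finset.mem_filter.1 hl
        obtain ⟨_, hc, hn, hmem⟩ := mem_sawLists.1 hl
        have hlast := getLastD_mem hy fun x hx => Finset.mem_of_mem_erase (hmem x hx)
        rw [edgeInfluence_of_not_adj _ _ fun h => hzo ⟨hzB, _, hlast, h.symm⟩, mul_zero]
  refine (Finset.sum_le_card_nsmul _ _ _ hz).trans ?_
  rw [nsmul_eq_mul]
  refine mul_le_mul_of_nonneg_right ?_ (by positivity)
  exact_mod_cast Finset.card_le_univ _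

/-- The total influence on the exits of a multi-vertex block of a vertex next to its outer
boundary. -/
theorem pathSum_exitInfluence_le (hε : 0 < ε) (hε1 : ε < 1) (hd : 2 ≤ d) {B : Finset V}
    (hB : IsTreePlusAtMostOneEdge (G.induce (B : Set V)))
    (hbd : ∀ w ∈ outerBoundary G B, IsBlockVertex G J β d ε w)
    (huniq : ∀ w ∈ outerBoundary G B, ∃! v, v ∈ B ∧ G.Adj w v) {u y : V} (hy : y ∈ B)
    (hu : u ∉ B) (hadj : G.Adj u y) {k : ℕ} (hk1 : 1 ≤ k)
    (hk : (k : ℝ) ≤ Real.log (Fintype.card V)) (hgap : gap ε ^ (k - 1) * (1 / (1 - ε / 4)) ≤ 1)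
    (K : ℕ) :
    pathSum (edgeInfluence G J β) (exitInfluence G J β B) K (B.erase y) y ≤
      gap ε * exitBound G J β d ε y + Fintype.card V * (24 / 4 ^ k) := by
  have hΓ := edgeInfluence_of_not_adj (G := G) (J := J) (β := β)
  have hshort := pathSum_exitInfluence_short_le hε hε1 hd hbd hy hu hadj hk1 hk hgap
  have hlong := sum_exitInfluence_long_le hε hε1 hd hB hbd huniq hy hu hadj hk1 hk K
  rw [pathSum_eq_sum_sawLists hΓ] at hshort ⊢
  rw [← Finset.sum_filter_add_sum_filter_not _ (fun l => l.length ≤ 2 * k - 1)]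
  refine add_le_add (le_trans ?_ hshort) hlong
  refine Finset.sum_le_sum_of_subset_of_nonneg ?_ fun l _ _ =>
    mul_nonneg (pathProd_nonneg (edgeInfluence_nonneg G J β) _ _) (exitInfluence_nonneg _ _)
  intro l hl
  obtain ⟨hl, hlen⟩ := Finset.mem_filter.1 hl
  obtain ⟨_, h⟩ := mem_sawLists.1 hl
  exact mem_sawLists.2 ⟨hlen, h⟩

/-! ### Contraction of weighted oscillations -/

/-- The weight of a disagreement at `x`: its influence on the other blocks, discounted by
`exitBound`, plus a small constant `η` that keeps the weight positive in the interior of blocks. -/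
def boundaryWeight (G : SimpleGraph V) (J : Sym2 V → ℝ) (β d ε η : ℝ)
    (𝓑 : Finpartition (Finset.univ : Finset V)) (x : V) : ℝ :=
  η + ∑ z ∈ (𝓑.part x)ᶜ, edgeInfluence G J β x z * exitBound G J β d ε z

omit [DecidableEq V] in
theorem exitBound_nonneg (hε : 0 < ε) (hε1 : ε < 1) (v : V) : 0 ≤ exitBound G J β d ε v :=
  zero_le_one.trans (one_le_exitBound hε hε1 v)

theorem le_boundaryWeight (hε : 0 < ε) (hε1 : ε < 1) (η : ℝ)
    (𝓑 : Finpartition (Finset.univ : Finset V)) (x : V) :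
    η ≤ boundaryWeight G J β d ε η 𝓑 x :=
  le_add_of_nonneg_right (Finset.sum_nonneg fun z _ =>
    mul_nonneg (edgeInfluence_nonneg G J β x z) (exitBound_nonneg hε hε1 z))

theorem boundaryWeight_le (hε : 0 < ε) (hε1 : ε < 1) (η : ℝ)
    (𝓑 : Finpartition (Finset.univ : Finset V)) (x : V) :
    boundaryWeight G J β d ε η 𝓑 x ≤ η + Fintype.card V * 2 := by
  refine add_le_add le_rfl ?_
  have h : ∀ z ∈ (𝓑.part x)ᶜ, edgeInfluence G J β x z * exitBound G J β d ε z ≤ 2 := by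
    intro z _
    have h1 := exitBound_le (G := G) (J := J) (β := β) (d := d) hε hε1 z
    have h2 : 1 / (1 - ε / 4) ≤ 2 := by rw [div_le_iff₀] <;> linarith
    have h3 := edgeInfluence_le_one (G := G) (J := J) (β := β) x z
    have h4 := edgeInfluence_nonneg G J β x z
    have h5 := exitBound_nonneg (G := G) (J := J) (β := β) (d := d) hε hε1 z
    nlinarith
  refine (Finset.sum_le_card_nsmul _ _ _ h).trans ?_
  rw [nsmul_eq_mul]
  refine mul_le_mul_of_nonneg_right ?_ zero_le_two
  exact_mod_cast Finset.card_le_univ _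

/-- A disagreement at a vertex `y` with a neighbour outside its block causes, after its block has been
resampled, a total weight of disagreements below the exit bound at `y`. -/
theorem pathSum_boundaryWeight_le (hε : 0 < ε) (hε1 : ε < 1) (hd : 2 ≤ d)
    {𝓑 : Finpartition (Finset.univ : Finset V)} (h𝓑 : IsBlockPartition G J β d ε 𝓑)
    {η τ : ℝ} (hη : 0 ≤ η) (hητ : 3 * Fintype.card V * η ≤ τ)
    {B : Finset V} (hBp : B ∈ 𝓑.parts)
    {u y : V} (hy : y ∈ B) (hu : u ∉ B) (hadj : G.Adj u y)
    {k : ℕ} (hk1 : 1 < B.card → 1 ≤ k)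
    (hk : (k : ℝ) ≤ Real.log (Fintype.card V))
    (hgap : 1 < B.card → gap ε ^ (k - 1) * (1 / (1 - ε / 4)) ≤ 1)
    (hlong : 1 < B.card → Fintype.card V * (24 / 4 ^ k) ≤ τ) (K : ℕ) :
    pathSum (edgeInfluence G J β) (boundaryWeight G J β d ε η 𝓑) K (B.erase y) y ≤
      (gap ε + 2 * τ) * exitBound G J β d ε y := by
  have hg0 := gap_pos hε1
  have hh := one_le_exitBound (G := G) (J := J) (β := β) (d := d) hε hε1 y
  have hn : (1 : ℝ) ≤ Fintype.card V := by
    exact_mod_cast Fintype.card_pos_iff.2 ⟨y⟩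
  have hητ' : η ≤ τ := by nlinarith
  have hτ : 0 ≤ τ := hη.trans hητ'
  have hpart : ∀ x ∈ B, 𝓑.part x = B := fun x hx => 𝓑.part_eq_of_mem hBp hx
  rcases (Nat.one_le_iff_ne_zero.2 (Finset.card_ne_zero_of_mem hy)).lt_or_eq with hcard | hcard
  · have hΓ := edgeInfluence_of_not_adj (G := G) (J := J) (β := β)
    have hbd := h𝓑.boundary_blockVertex B hBp hcard
    have hB := h𝓑.tree_or_unicyclic B hBp
    have hw : ∀ x ∈ B, boundaryWeight G J β d ε η 𝓑 x = exitInfluence G J β B x + η := by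
      intro x hx
      rw [boundaryWeight, hpart x hx, add_comm, exitInfluence]
      congr 1
      refine Finset.sum_congr (by congr!) fun z hz => ?_
      by_cases hxz : G.Adj x z
      · rw [exitBound, if_pos (hbd z ⟨Finset.mem_compl.1 hz, x, hx, hxz.symm⟩), mul_one]
      · rw [hΓ x z hxz, zero_mul]
    have hexit := pathSum_exitInfluence_le hε hε1 hd hB hbd
      (h𝓑.boundary_unique_neighbour B hBp hcard) hy hu hadj (hk1 hcard) hk (hgap hcard) K
    rw [pathSum_eq_sum_sawLists hΓ] at hexit ⊢
    have e : ∑ l ∈ sawLists G K (B.erase y) y, pathProd (edgeInfluence G J β) y l *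
        boundaryWeight G J β d ε η 𝓑 (l.getLastD y) =
        ∑ l ∈ sawLists G K (B.erase y) y, pathProd (edgeInfluence G J β) y l *
          exitInfluence G J β B (l.getLastD y) +
        ∑ l ∈ sawLists G K (B.erase y) y, pathProd (edgeInfluence G J β) y l * η := by
      rw [← Finset.sum_add_distrib]
      refine Finset.sum_congr rfl fun l hl => ?_
      obtain ⟨_, _, _, hmem⟩ := mem_sawLists.1 hl
      rw [hw _ (getLastD_mem hy fun x hx => Finset.mem_of_mem_erase (hmem x hx)), mul_add]
    have hcount : ∑ l ∈ sawLists G K (B.erase y) y, pathProd (edgeInfluence G J β) y l * η ≤ τ := by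
      refine (Finset.sum_le_card_nsmul _ _ η fun l _ => mul_le_of_le_one_left hη
        (pathProd_le_one (edgeInfluence_nonneg G J β) edgeInfluence_le_one _ _)).trans ?_
      rw [nsmul_eq_mul]
      refine le_trans (mul_le_mul_of_nonneg_right ?_ hη) hητ
      exact_mod_cast card_sawLists_le hB hy K
    have hl := hlong hcard
    rw [e]
    nlinarith
  · have hB1 : B.erase y = ∅ := by
      rw [← Finset.card_eq_zero, Finset.card_erase_of_mem hy]
      omega
    have hyb := h𝓑.single_vertex B hBp hcard.symm y hy
    have hps : pathSum (edgeInfluence G J β) (boundaryWeight G J β d ε η 𝓑) K (B.erase y) y =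
        boundaryWeight G J β d ε η 𝓑 y := by
      rw [hB1]
      cases K <;> simp [pathSum]
    have hsum : ∑ z ∈ (𝓑.part y)ᶜ, edgeInfluence G J β y z * exitBound G J β d ε z ≤ gap ε := by
      have h1 := sum_edgeInfluence_le (G := G) (J := J) (β := β) y (𝓑.part y)ᶜ
      calc _ ≤ ∑ z ∈ (𝓑.part y)ᶜ, edgeInfluence G J β y z * (1 / (1 - ε / 4)) :=
            Finset.sum_le_sum fun z _ => mul_le_mul_of_nonneg_left (exitBound_le hε hε1 z)
              (edgeInfluence_nonneg G J β y z)
        _ ≤ (1 - ε / 2) * (1 / (1 - ε / 4)) := by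
            rw [← Finset.sum_mul]
            exact mul_le_mul_of_nonneg_right (h1.trans (hyb.aggInfluence_le hε1 hd))
              (one_div_nonneg.2 (by linarith))
        _ = gap ε := by rw [gap]; ring
    rw [hps, boundaryWeight]
    nlinarith

omit [Fintype V] in
theorem pathSum_const_mul (Γ : V → V → ℝ) (w : V → ℝ) (c : ℝ) (K : ℕ) (B : Finset V) (u : V) :
    pathSum Γ (fun x => c * w x) K B u = c * pathSum Γ w K B u := by
  induction K generalizing B u with
  | zero => rfl
  | succ K ih =>
    simp only [pathSum, ih, mul_add, Finset.mul_sum]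
    congr 1
    exact Finset.sum_congr rfl fun v _ => by ring

theorem sum_gibbs_pos (G : SimpleGraph V) (J : Sym2 V → ℝ) (β : ℝ) :
    0 < ∑ τ : V → ℤˣ, Real.exp (β * interaction G J τ) :=
  Finset.sum_pos (fun _ _ => Real.exp_pos _) Finset.univ_nonempty

theorem gibbs_pos (G : SimpleGraph V) (J : Sym2 V → ℝ) (β : ℝ) (σ : V → ℤˣ) :
    0 < gibbs G J β σ := div_pos (Real.exp_pos _) (sum_gibbs_pos G J β)

theorem sum_gibbs (G : SimpleGraph V) (J : Sym2 V → ℝ) (β : ℝ) :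
    ∑ σ, gibbs G J β σ = 1 := by
  simp only [gibbs]
  rw [← Finset.sum_div, div_self (sum_gibbs_pos G J β).ne']

theorem sum_blockUpdate_mul (μ : (V → ℤˣ) → ℝ) (B : Finset V) (f : (V → ℤˣ) → ℝ) (σ : V → ℤˣ) :
    ∑ τ, blockUpdate μ B σ τ * f τ = condMean μ B f σ := by
  classical
  rw [condMean, fiberSum, fiberSum, Finset.sum_div]
  refine Finset.sum_congr rfl fun τ _ => ?_
  rw [blockUpdate]
  split_ifs <;> simp [div_mul_eq_mul_div]

theorem condMean_gibbs (B : Finset V) (f : (V → ℤˣ) → ℝ) (σ : V → ℤˣ) :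
    condMean (gibbs G J β) B f σ = condMean (fieldWeight G J β 0) B f σ := by
  refine condMean_congr_weight (c := (∑ τ : V → ℤˣ, Real.exp (β * interaction G J τ))⁻¹)
    (inv_pos.2 (sum_gibbs_pos G J β)).ne' (fun τ _ => ?_) f
  rw [gibbs, fieldWeight]
  simp [div_eq_inv_mul]

theorem blockDynamics_mulVec (𝓑 : Finpartition (Finset.univ : Finset V)) (f : (V → ℤˣ) → ℝ)
    (σ : V → ℤˣ) :
    (blockDynamics (gibbs G J β) 𝓑).mulVec f σ =
      1 / (𝓑.parts.card : ℝ) * ∑ B ∈ 𝓑.parts, condMean (fieldWeight G J β 0) B f σ := by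
  simp only [Matrix.mulVec, dotProduct, blockDynamics]
  simp only [mul_assoc, Finset.sum_mul]
  rw [← Finset.mul_sum, Finset.sum_comm]
  congr 1
  refine Finset.sum_congr rfl fun B _ => ?_
  rw [sum_blockUpdate_mul, condMean_gibbs]

theorem sum_parts_sum (𝓑 : Finpartition (Finset.univ : Finset V)) (F : V → ℝ) :
    ∑ B ∈ 𝓑.parts, ∑ v ∈ B, F v = ∑ v, F v := by
  have h := Finset.sum_biUnion (f := F) 𝓑.disjoint
  rw [𝓑.biUnion_parts] at h
  exact h.symm

/-- The block dynamics contracts weighted oscillations. Resampling the block of `u` removes the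
dependence on the spin at `u`; the other blocks add to it at most the weight of `u`. -/
theorem abs_blockDynamics_mulVec_sub_le
    {𝓑 : Finpartition (Finset.univ : Finset V)} {η δ : ℝ} (hη : 0 ≤ η) (hδ : δ ≤ 1)
    (hcon : ∀ B ∈ 𝓑.parts, ∀ y ∈ B, ∀ u ∉ B, G.Adj u y → ∀ K,
      pathSum (edgeInfluence G J β) (boundaryWeight G J β d ε η 𝓑) K (B.erase y) y ≤
        (1 - δ) * exitBound G J β d ε y)
    {f : (V → ℤˣ) → ℝ} {c : ℝ} (hc : 0 ≤ c)
    (hf : ∀ u σ, |f (update σ u 1) - f (update σ u (-1))| ≤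
      c * boundaryWeight G J β d ε η 𝓑 u) (u : V) (σ : V → ℤˣ) :
    |(blockDynamics (gibbs G J β) 𝓑).mulVec f (update σ u 1) -
        (blockDynamics (gibbs G J β) 𝓑).mulVec f (update σ u (-1))| ≤
      (1 - δ / 𝓑.parts.card) * c * boundaryWeight G J β d ε η 𝓑 u := by
  set w := boundaryWeight G J β d ε η 𝓑 with hw
  set Γ := edgeInfluence G J β with hΓ
  have hΓ0 : ∀ u v, 0 ≤ Γ u v := edgeInfluence_nonneg G J β
  have hP : 𝓑.part u ∈ 𝓑.parts := 𝓑.part_mem.2 (Finset.mem_univ u)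
  have huP : u ∈ 𝓑.part u := 𝓑.mem_part (Finset.mem_univ u)
  have hN : (0 : ℝ) < 𝓑.parts.card := by
    exact_mod_cast Finset.card_pos.2 ⟨_, hP⟩
  set D : Finset V → ℝ := fun B => condMean (fieldWeight G J β 0) B f (update σ u 1) -
    condMean (fieldWeight G J β 0) B f (update σ u (-1)) with hD
  have hDP : D (𝓑.part u) = 0 := by
    have : ∀ v, v ∉ 𝓑.part u → update σ u 1 v = update σ u (-1) v := by
      intro v hv
      have hvu : v ≠ u := fun e => hv (e ▸ huP)
      simp [hvu]
    simp only [hD, condMean]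
    rw [fiberSum_congr_config _ this, fiberSum_congr_config _ this, sub_self]
  have hDB : ∀ B ∈ 𝓑.parts.erase (𝓑.part u), |D B| ≤
      c * w u + c * (1 - δ) * ∑ v ∈ B, Γ u v * exitBound G J β d ε v := by
    intro B hB
    obtain ⟨hne, hB⟩ := Finset.mem_erase.1 hB
    have huB : u ∉ B := fun h => hne (𝓑.part_eq_of_mem hB h).symm
    refine (abs_condMean_update_sub_le G J β hf (B.card + 1) B (Nat.le_succ _) 0 σ u huB).trans ?_
    rw [pathSum_const_mul, pathSum, mul_add, mul_assoc c (1 - δ)]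
    refine add_le_add le_rfl (mul_le_mul_of_nonneg_left ?_ hc)
    rw [Finset.mul_sum]
    refine Finset.sum_le_sum fun v hv => ?_
    by_cases hadj : G.Adj u v
    · rw [mul_left_comm]
      exact mul_le_mul_of_nonneg_left (hcon B hB v hv u huB hadj _) (hΓ0 u v)
    · simp [hΓ, edgeInfluence_of_not_adj u v hadj]
  have hsum : ∑ B ∈ 𝓑.parts.erase (𝓑.part u), ∑ v ∈ B, Γ u v * exitBound G J β d ε v ≤ w u := by
    have h1 := sum_parts_sum 𝓑 fun v => Γ u v * exitBound G J β d ε v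
    rw [← Finset.add_sum_erase _ _ hP, ← Finset.sum_add_sum_compl (𝓑.part u)] at h1
    have h2 := add_left_cancel h1
    rw [h2, hw, boundaryWeight]
    linarith
  have hcardE : ((𝓑.parts.erase (𝓑.part u)).card : ℝ) = 𝓑.parts.card - 1 := by
    rw [Finset.card_erase_of_mem hP, Nat.cast_sub (Finset.card_pos.2 ⟨_, hP⟩), Nat.cast_one]
  rw [blockDynamics_mulVec, blockDynamics_mulVec, ← mul_sub, ← Finset.sum_sub_distrib, abs_mul,
    abs_of_nonneg (by positivity : 0 ≤ 1 / (𝓑.parts.card : ℝ)), one_div, inv_mul_le_iff₀ hN]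
  calc |∑ B ∈ 𝓑.parts, D B| ≤ ∑ B ∈ 𝓑.parts, |D B| := Finset.abs_sum_le_sum_abs _ _
    _ = ∑ B ∈ 𝓑.parts.erase (𝓑.part u), |D B| := by
        rw [← Finset.add_sum_erase _ _ hP, hDP, abs_zero, zero_add]
    _ ≤ ∑ B ∈ 𝓑.parts.erase (𝓑.part u),
          (c * w u + c * (1 - δ) * ∑ v ∈ B, Γ u v * exitBound G J β d ε v) := Finset.sum_le_sum hDB
    _ = (𝓑.parts.card - 1) * (c * w u) + c * (1 - δ) *
          ∑ B ∈ 𝓑.parts.erase (𝓑.part u), ∑ v ∈ B, Γ u v * exitBound G J β d ε v := by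
        rw [Finset.sum_add_distrib, Finset.sum_const, nsmul_eq_mul, hcardE, Finset.mul_sum]
    _ ≤ (𝓑.parts.card - 1) * (c * w u) + c * (1 - δ) * w u := by
        refine add_le_add le_rfl (mul_le_mul_of_nonneg_left hsum ?_)
        exact mul_nonneg hc (by linarith)
    _ = 𝓑.parts.card * ((1 - δ / 𝓑.parts.card) * c * w u) := by
        field_simp
        ring

end Contraction

/-! ### Mixing time -/

section Mixing

variable {V : Type*} [Fintype V] [DecidableEq V] {G : SimpleGraph V} {J : Sym2 V → ℝ} {β : ℝ}
  {d ε : ℝ}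

/-- Oscillations at single vertices add up along a path of single-spin flips. -/
theorem abs_sub_le_sum_of_forall_update {F : (V → ℤˣ) → ℝ} {g : V → ℝ}
    (hF : ∀ u σ, |F (update σ u 1) - F (update σ u (-1))| ≤ g u) (σ σ' : V → ℤˣ) :
    |F σ' - F σ| ≤ ∑ u, g u := by
  have hone : ∀ (u : V) (s : ℤˣ) (ρ : V → ℤˣ), |F (update ρ u s) - F ρ| ≤ g u := by
    intro u s ρ
    have h := hF u ρ
    have h0 := (abs_nonneg _).trans h
    conv_lhs => rw [← update_eq_self u ρ, update_idem]
    rcases Int.units_eq_one_or s with hs | hs <;> rcases Int.units_eq_one_or (ρ u) with hr | hr <;>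
      rw [hs, hr]
    · simpa using h0
    · exact h
    · rwa [abs_sub_comm]
    · simpa using h0
  have key : ∀ S : Finset V, |F (S.piecewise σ' σ) - F σ| ≤ ∑ u ∈ S, g u := by
    intro S
    induction S using Finset.induction_on with
    | empty => simp
    | insert u S hu ih =>
      rw [Finset.sum_insert hu, Finset.piecewise_insert]
      exact (abs_sub_le _ (F (S.piecewise σ' σ)) _).trans (add_le_add (hone u _ _) ih)
  simpa using key Finset.univ

theorem blockUpdate_reversible (μ : (V → ℤˣ) → ℝ) (B : Finset V) (σ τ : V → ℤˣ) :
    μ σ * blockUpdate μ B σ τ = μ τ * blockUpdate μ B τ σ := by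
  classical
  rw [blockUpdate, blockUpdate]
  by_cases h : ∀ v, v ∉ B → τ v = σ v
  · rw [if_pos h, if_pos fun v hv => (h v hv).symm]
    have := fiberSum_congr_config μ h
    simp only [fiberSum] at this
    rw [this]
    ring
  · rw [if_neg h, if_neg fun h' => h fun v hv => (h' v hv).symm, mul_zero, mul_zero]

theorem blockDynamics_mulVec_one {𝓑 : Finpartition (Finset.univ : Finset V)}
    (hN : 𝓑.parts.card ≠ 0) (σ : V → ℤˣ) :
    (blockDynamics (gibbs G J β) 𝓑).mulVec 1 σ = 1 := by
  have h : ∀ B : Finset V, condMean (fieldWeight G J β 0) B 1 σ = 1 := by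
    intro B
    have := (fiberSum_pos (B := B) (σ := σ) (fieldWeight_pos G J β 0)).ne'
    simp only [condMean, Pi.one_apply, mul_one]
    exact div_self this
  rw [blockDynamics_mulVec]
  simp only [h, Finset.sum_const, nsmul_eq_mul, mul_one]
  field_simp

theorem gibbs_vecMul_blockDynamics {𝓑 : Finpartition (Finset.univ : Finset V)}
    (hN : 𝓑.parts.card ≠ 0) :
    Matrix.vecMul (gibbs G J β) (blockDynamics (gibbs G J β) 𝓑) = gibbs G J β := by
  funext τ
  have h1 := blockDynamics_mulVec_one (G := G) (J := J) (β := β) hN τ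
  simp only [Matrix.mulVec, dotProduct, Pi.one_apply, mul_one] at h1
  simp only [Matrix.vecMul, dotProduct]
  have h2 : ∀ σ, gibbs G J β σ * blockDynamics (gibbs G J β) 𝓑 σ τ =
      gibbs G J β τ * blockDynamics (gibbs G J β) 𝓑 τ σ := by
    intro σ
    simp only [blockDynamics]
    rw [mul_left_comm, mul_left_comm (gibbs G J β τ)]
    congr 1
    rw [Finset.mul_sum, Finset.mul_sum]
    exact Finset.sum_congr rfl fun B _ => blockUpdate_reversible _ B σ τ
  simp only [h2]
  rw [← Finset.mul_sum, h1, mul_one]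

theorem gibbs_vecMul_blockDynamics_pow {𝓑 : Finpartition (Finset.univ : Finset V)}
    (hN : 𝓑.parts.card ≠ 0) (t : ℕ) :
    Matrix.vecMul (gibbs G J β) (blockDynamics (gibbs G J β) 𝓑 ^ t) = gibbs G J β := by
  induction t with
  | zero => simp
  | succ t ih => rw [pow_succ, ← Matrix.vecMul_vecMul, ih, gibbs_vecMul_blockDynamics hN]

/-- Exponential decay of the distance to equilibrium from the contraction of oscillations. -/
theorem tvDist_blockDynamics_pow_le (hε : 0 < ε) (hε1 : ε < 1)
    {𝓑 : Finpartition (Finset.univ : Finset V)} (hN : 𝓑.parts.card ≠ 0)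
    {η δ : ℝ} (hη : 0 < η) (hδ : δ ≤ 1)
    (hcon : ∀ B ∈ 𝓑.parts, ∀ y ∈ B, ∀ u ∉ B, G.Adj u y → ∀ K,
      pathSum (edgeInfluence G J β) (boundaryWeight G J β d ε η 𝓑) K (B.erase y) y ≤
        (1 - δ) * exitBound G J β d ε y) (σ : V → ℤˣ) (t : ℕ) :
    tvDist ((blockDynamics (gibbs G J β) 𝓑 ^ t) σ) (gibbs G J β) ≤
      Fintype.card V * (1 + 2 * Fintype.card V / η) * Real.exp (-(δ / 𝓑.parts.card * t)) := by
  classical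
  set P := blockDynamics (gibbs G J β) 𝓑 with hP
  set μ := gibbs G J β with hμ
  set w := boundaryWeight G J β d ε η 𝓑 with hw
  have hN1 : (1 : ℝ) ≤ 𝓑.parts.card := by exact_mod_cast Nat.one_le_iff_ne_zero.2 hN
  have hδN : δ / 𝓑.parts.card ≤ 1 := by
    rw [div_le_one (by linarith)]
    linarith
  set r := 1 - δ / 𝓑.parts.card with hr
  have hr0 : 0 ≤ r := by linarith
  have hwη : ∀ u, η ≤ w u := le_boundaryWeight hε hε1 η 𝓑
  -- The test function that attains the total variation distance.
  set f : (V → ℤˣ) → ℝ := fun τ => if 0 ≤ (P ^ t) σ τ - μ τ then 1 else -1 with hf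
  have hf1 : ∀ τ, |f τ| ≤ 1 := by
    intro τ
    simp only [hf]
    split_ifs <;> simp
  have hosc : ∀ (s : ℕ) (u : V) (ρ : V → ℤˣ),
      |(P ^ s).mulVec f (update ρ u 1) - (P ^ s).mulVec f (update ρ u (-1))| ≤
        (r ^ s * (2 / η)) * w u := by
    intro s
    induction s with
    | zero =>
      intro u ρ
      rw [pow_zero, Matrix.one_mulVec, pow_zero, one_mul]
      have h1 : |f (update ρ u 1) - f (update ρ u (-1))| ≤ 2 := by
        refine (abs_sub _ _).trans ?_
        linarith [hf1 (update ρ u 1), hf1 (update ρ u (-1))]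
      refine h1.trans ?_
      rw [div_mul_eq_mul_div, le_div_iff₀ hη]
      linarith [hwη u]
    | succ s ih =>
      intro u ρ
      rw [pow_succ', ← Matrix.mulVec_mulVec]
      refine (abs_blockDynamics_mulVec_sub_le hη.le hδ hcon (by positivity) ih u ρ).trans
        (le_of_eq ?_)
      rw [pow_succ']
      ring
  have htv : ∑ τ, |(P ^ t) σ τ - μ τ| =
      ∑ ρ, μ ρ * ((P ^ t).mulVec f σ - (P ^ t).mulVec f ρ) := by
    have h1 : ∀ τ, |(P ^ t) σ τ - μ τ| = (P ^ t) σ τ * f τ - μ τ * f τ := by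
      intro τ
      simp only [hf]
      split_ifs with h
      · rw [abs_of_nonneg h]; ring
      · rw [abs_of_neg (not_le.1 h)]; ring
    have h2 : ∑ τ, μ τ * f τ = ∑ ρ, μ ρ * (P ^ t).mulVec f ρ := by
      have h3 : μ ⬝ᵥ f = Matrix.vecMul μ (P ^ t) ⬝ᵥ f := by
        rw [hP, gibbs_vecMul_blockDynamics_pow hN]
      rw [← Matrix.dotProduct_mulVec] at h3
      exact h3
    simp only [h1, mul_sub, Finset.sum_sub_distrib]
    rw [h2, ← Finset.sum_mul, sum_gibbs, one_mul]
    rfl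
  have hbound : ∀ ρ, (P ^ t).mulVec f σ - (P ^ t).mulVec f ρ ≤
      (r ^ t * (2 / η)) * (Fintype.card V * (η + Fintype.card V * 2)) := by
    intro ρ
    refine (le_abs_self _).trans ((abs_sub_le_sum_of_forall_update (hosc t) ρ σ).trans ?_)
    rw [← Finset.mul_sum]
    refine mul_le_mul_of_nonneg_left ?_ (by positivity)
    refine (Finset.sum_le_card_nsmul _ _ _ fun u _ => boundaryWeight_le hε hε1 η 𝓑 u).trans ?_
    rw [nsmul_eq_mul, Finset.card_univ]
  have hrexp : r ^ t ≤ Real.exp (-(δ / 𝓑.parts.card * t)) := by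
    have h1 : r ≤ Real.exp (-(δ / 𝓑.parts.card)) := by
      have := Real.add_one_le_exp (-(δ / 𝓑.parts.card))
      linarith
    refine (pow_le_pow_left₀ hr0 h1 t).trans (le_of_eq ?_)
    rw [← Real.exp_nat_mul]
    congr 1
    ring
  rw [tvDist, htv]
  have hfin : ∑ ρ, μ ρ * ((P ^ t).mulVec f σ - (P ^ t).mulVec f ρ) ≤
      (r ^ t * (2 / η)) * (Fintype.card V * (η + Fintype.card V * 2)) := by
    refine (Finset.sum_le_sum fun ρ _ => mul_le_mul_of_nonneg_left (hbound ρ)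
      (gibbs_pos G J β ρ).le).trans (le_of_eq ?_)
    rw [← Finset.sum_mul, sum_gibbs, one_mul]
  calc _ ≤ 1 / 2 * ((r ^ t * (2 / η)) * (Fintype.card V * (η + Fintype.card V * 2))) := by gcongr
    _ = Fintype.card V * (1 + 2 * Fintype.card V / η) * r ^ t := by
        field_simp
    _ ≤ _ := by gcongr

theorem blockMixingTime_le {𝓑 : Finpartition (Finset.univ : Finset V)} {t : ℕ} (ht : 0 < t)
    (h : ∀ σ, tvDist ((blockDynamics (gibbs G J β) 𝓑 ^ t) σ) (gibbs G J β) ≤ 1 / Real.exp 1) :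
    blockMixingTime G J β 𝓑 ≤ t :=
  iSup_le fun σ => iInf_le_of_le ⟨t, ht, h σ⟩ le_rfl

/-- A vertex of a multi-vertex block with a neighbour outside has degree at least two, which is
impossible in the class unless the graph is large. -/
theorem InClass.log_card_ge (hβ : 0 < β) (hd : 2 ≤ d) (h : InClass d ε G J β)
    {B : Finset V} (hB : IsTreePlusAtMostOneEdge (G.induce (B : Set V))) (hcard : 1 < B.card)
    {u y : V} (hy : y ∈ B) (hu : u ∉ B) (hadj : G.Adj u y) :
    Real.log 2 * Real.log d ^ 2 ≤ Real.log (Fintype.card V) := by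
  classical
  obtain ⟨T, hTle, hT, _⟩ := hB
  have hnt : Nontrivial (B : Set V) := by
    obtain ⟨a, ha, b, hb, hab⟩ := Finset.one_lt_card.1 hcard
    exact ⟨⟨⟨a, ha⟩, ⟨b, hb⟩, by simpa using hab⟩⟩
  obtain ⟨⟨v, hv⟩, hyv⟩ := hT.connected.preconnected.exists_adj_of_nontrivial ⟨y, hy⟩
  have hyv' : G.Adj y v := hTle hyv
  have hne : u ≠ v := fun e => hu (e ▸ hv)
  have hdeg : 2 ≤ G.degree y := by
    rw [← Finset.card_pair hne, ← G.card_neighborFinset_eq_degree]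
    refine Finset.card_le_card ?_
    intro x hx
    rw [SimpleGraph.mem_neighborFinset]
    rcases Finset.mem_insert.1 hx with rfl | hx
    · exact hadj.symm
    · rw [Finset.mem_singleton.1 hx]; exact hyv'
  have hlogd : 0 < Real.log d := Real.log_pos (by linarith)
  have hpw := h.path_weight_le y y SimpleGraph.Walk.nil SimpleGraph.Walk.IsPath.nil (by
    simp only [SimpleGraph.Walk.length_nil, Nat.cast_zero]
    exact div_nonneg (Real.log_natCast_nonneg _) (by positivity))
  rw [le_div_iff₀ (by positivity)] at hpw
  refine le_trans (mul_le_mul_of_nonneg_right ?_ (by positivity)) hpw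
  rw [comparisonWeight]
  refine le_add_of_nonneg_of_le (mul_nonneg hβ.le (Finset.sum_nonneg fun _ _ => abs_nonneg _)) ?_
  simp only [SimpleGraph.Walk.support_nil, List.map_cons, List.map_nil, List.sum_cons,
    List.sum_nil, add_zero]
  refine Real.log_le_log two_pos ?_
  have hdeg' : (2 : ℝ) ≤ (G.degree y : ℝ) := by exact_mod_cast hdeg
  convert hdeg'

/-- The time at which the exponential bound falls below `1 / e` is `O(N log N)`. -/
theorem exists_time_le {δ Q c : ℝ} (hδ : 0 < δ) (hQ : 1 ≤ Q) (hc : 0 < c) :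
    ∃ C : ℝ, 0 < C ∧ ∀ n N : ℕ, 1 ≤ n → 2 ≤ N → c * Real.sqrt n ≤ N →
      ∃ t : ℕ, 0 < t ∧ (t : ℝ) ≤ C * (N * Real.log N) ∧
        n ^ 3 * Q * Real.exp (-(δ / N * t)) ≤ 1 / Real.exp 1 := by
  set S := 1 + Real.log Q + 6 * |Real.log c| with hS
  have hlQ := Real.log_nonneg hQ
  have hS1 : 1 ≤ S := by have := abs_nonneg (Real.log c); linarith
  refine ⟨(2 * S + 6) / δ + 1, by positivity, fun n N hn hN hcn => ?_⟩
  have hN2 : (2 : ℝ) ≤ N := by exact_mod_cast hN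
  have hn1 : (1 : ℝ) ≤ n := by exact_mod_cast hn
  have hlogN : 1 / 2 ≤ Real.log N := by
    have := Real.log_le_log two_pos hN2
    linarith [Real.log_two_gt_d9]
  have hlogn : Real.log n ≤ 2 * Real.log N + 2 * |Real.log c| := by
    have h1 := Real.log_le_log (mul_pos hc (Real.sqrt_pos.2 (by linarith))) hcn
    rw [Real.log_mul hc.ne' (Real.sqrt_pos.2 (by linarith)).ne', Real.log_sqrt (by linarith)] at h1
    have := neg_abs_le (Real.log c)
    linarith
  set t0 := N / δ * (S + 6 * Real.log N) with ht0
  have ht0pos : 0 < t0 := by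
    have : 0 < S + 6 * Real.log N := by linarith
    positivity
  refine ⟨⌈t0⌉₊, Nat.ceil_pos.2 ht0pos, ?_, ?_⟩
  · have h1 := (Nat.ceil_lt_add_one ht0pos.le).le
    have h2 : (1 : ℝ) ≤ N * Real.log N := by nlinarith
    have h3 : t0 ≤ N / δ * ((2 * S + 6) * Real.log N) := by
      refine mul_le_mul_of_nonneg_left ?_ (by positivity)
      nlinarith
    calc (⌈t0⌉₊ : ℝ) ≤ N / δ * ((2 * S + 6) * Real.log N) + N * Real.log N := by linarith
      _ = _ := by ring
  · have h1 : S + 6 * Real.log N ≤ δ / N * ⌈t0⌉₊ := by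
      have h2 := mul_le_mul_of_nonneg_left (Nat.le_ceil t0) (by positivity : 0 ≤ δ / N)
      refine le_trans (le_of_eq ?_) h2
      rw [ht0]
      field_simp
    have h3 : (n : ℝ) ^ 3 * Q = Real.exp (3 * Real.log n + Real.log Q) := by
      rw [Real.exp_add, Real.exp_log (by linarith), show (3 : ℝ) * Real.log n =
        ((3 : ℕ) : ℝ) * Real.log n by norm_num, Real.exp_nat_mul, Real.exp_log (by linarith)]
    rw [h3, ← Real.exp_add, one_div, ← Real.exp_neg]
    refine Real.exp_le_exp.2 ?_
    linarith

/-- How large `k`, the integer part of `log n`, has to be. -/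
theorem exists_threshold (hε : 0 < ε) (hε1 : ε < 1) {τ : ℝ} (hτ : 0 < τ) :
    ∃ k₀ : ℕ, ∀ k ≥ k₀, 1 ≤ k ∧ gap ε ^ (k - 1) * (1 / (1 - ε / 4)) ≤ 1 ∧
      24 * Real.exp 1 * (Real.exp 1 / 4) ^ k ≤ τ := by
  have h1 : Filter.Tendsto (fun k : ℕ => gap ε ^ (k - 1) * (1 / (1 - ε / 4))) Filter.atTop
      (nhds (0 * (1 / (1 - ε / 4)))) :=
    ((tendsto_pow_atTop_nhds_zero_of_lt_one (gap_pos hε1).le (gap_lt_one hε hε1)).comp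
      (Filter.tendsto_sub_atTop_nat 1)).mul_const _
  have he : Real.exp 1 / 4 < 1 := by linarith [Real.exp_one_lt_d9]
  have h2 : Filter.Tendsto (fun k : ℕ => 24 * Real.exp 1 * (Real.exp 1 / 4) ^ k) Filter.atTop
      (nhds (24 * Real.exp 1 * 0)) :=
    (tendsto_pow_atTop_nhds_zero_of_lt_one (by positivity) he).const_mul _
  rw [zero_mul] at h1
  rw [mul_zero] at h2
  exact Filter.eventually_atTop.1 ((Filter.eventually_ge_atTop 1).and
    ((h1.eventually (eventually_le_nhds zero_lt_one)).and (h2.eventually (eventually_le_nhds hτ))))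

omit [DecidableEq V] in
/-- With `k` the integer part of `log n`, the decay `4 ^ k` outweighs `n` because `e < 4`. -/
theorem card_div_four_pow_le (hn : 0 < Fintype.card V) :
    (Fintype.card V : ℝ) * (24 / 4 ^ ⌊Real.log (Fintype.card V)⌋₊) ≤
      24 * Real.exp 1 * (Real.exp 1 / 4) ^ ⌊Real.log (Fintype.card V)⌋₊ := by
  set k := ⌊Real.log (Fintype.card V)⌋₊
  have hn' : (0 : ℝ) < Fintype.card V := by exact_mod_cast hn
  have h1 : (Fintype.card V : ℝ) ≤ Real.exp 1 * Real.exp 1 ^ k := by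
    rw [← Real.exp_nat_mul, ← Real.exp_add, ← Real.log_le_iff_le_exp hn']
    have := Nat.lt_floor_add_one (Real.log (Fintype.card V))
    linarith
  calc _ ≤ (Real.exp 1 * Real.exp 1 ^ k) * (24 / 4 ^ k) := by gcongr
    _ = _ := by rw [div_pow]; ring

/-- The mixing time bound, with a constant that depends only on `ε` and `c`. -/
theorem exists_blockMixingTime_le (hε : 0 < ε) (hε1 : ε < 1) :
    ∃ d₀ : ℝ, 1 ≤ d₀ ∧ ∀ c : ℝ, 0 < c → ∃ C : ℝ, 0 < C ∧ ∀ d : ℝ, d₀ ≤ d → ∀ β : ℝ, 0 < β →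
      ∀ (V : Type u) [Fintype V] [DecidableEq V] (G : SimpleGraph V) (J : Sym2 V → ℝ),
        InClass d ε G J β → ∀ 𝓑 : Finpartition (Finset.univ : Finset V),
          IsBlockPartition G J β d ε 𝓑 → 2 ≤ 𝓑.parts.card →
          c * Real.sqrt (Fintype.card V) ≤ 𝓑.parts.card →
          ((blockMixingTime G J β 𝓑 : ℕ∞) : ENNReal) ≤
            ENNReal.ofReal (C * (𝓑.parts.card * Real.log 𝓑.parts.card)) := by
  have hg0 := gap_pos hε1
  have hg1 := gap_lt_one hε hε1
  set τ := (1 - gap ε) / 4 with hτ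
  have hτ0 : 0 < τ := by linarith
  obtain ⟨k₀, hk₀⟩ := exists_threshold hε hε1 hτ0
  have hlim : Filter.Tendsto (fun d : ℝ => Real.log 2 * Real.log d ^ 2) Filter.atTop
      Filter.atTop :=
    ((Filter.tendsto_pow_atTop two_ne_zero).comp Real.tendsto_log_atTop).const_mul_atTop
      (Real.log_pos one_lt_two)
  obtain ⟨d₁, hd₁⟩ := Filter.eventually_atTop.1 (hlim.eventually_ge_atTop (k₀ : ℝ))
  refine ⟨max 2 d₁, le_trans one_le_two (le_max_left _ _), fun c hc => ?_⟩
  obtain ⟨C, hC, htime⟩ := exists_time_le (δ := (1 - gap ε) / 2) (Q := 1 + 6 / τ) (c := c)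
    (by linarith) (le_add_of_nonneg_right (by positivity)) hc
  refine ⟨C, hC, fun d hd β hβ V _ _ G J hcl 𝓑 h𝓑 hN hcN => ?_⟩
  have hd2 : 2 ≤ d := (le_max_left _ _).trans hd
  have hN0 : 𝓑.parts.card ≠ 0 := by omega
  have hn : 1 ≤ Fintype.card V := by
    obtain ⟨B, hB⟩ := Finset.card_pos.1 (Nat.pos_of_ne_zero hN0)
    obtain ⟨v, _⟩ := 𝓑.nonempty_of_mem_parts hB
    exact Fintype.card_pos_iff.2 ⟨v⟩
  have hn' : (1 : ℝ) ≤ Fintype.card V := by exact_mod_cast hn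
  set η := τ / (3 * Fintype.card V) with hη
  have hη0 : 0 < η := by positivity
  have hητ : 3 * Fintype.card V * η = τ := by rw [hη]; field_simp
  have hcon : ∀ B ∈ 𝓑.parts, ∀ y ∈ B, ∀ u ∉ B, G.Adj u y → ∀ K,
      pathSum (edgeInfluence G J β) (boundaryWeight G J β d ε η 𝓑) K (B.erase y) y ≤
        (1 - (1 - gap ε) / 2) * exitBound G J β d ε y := by
    intro B hB y hy u hu hadj K
    have hk : 1 < B.card → k₀ ≤ ⌊Real.log (Fintype.card V)⌋₊ := fun hcard =>
      Nat.le_floor ((hd₁ d ((le_max_right _ _).trans hd)).trans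
        (hcl.log_card_ge hβ hd2 (h𝓑.tree_or_unicyclic B hB) hcard hy hu hadj))
    refine (pathSum_boundaryWeight_le hε hε1 hd2 h𝓑 hη0.le hητ.le hB hy hu hadj
      (k := ⌊Real.log (Fintype.card V)⌋₊) (fun h => (hk₀ _ (hk h)).1)
      (Nat.floor_le (Real.log_natCast_nonneg _)) (fun h => (hk₀ _ (hk h)).2.1)
      (fun h => (card_div_four_pow_le hn).trans (hk₀ _ (hk h)).2.2) K).trans (le_of_eq ?_)
    rw [hτ]
    ring
  obtain ⟨t, ht0, htC, ht⟩ := htime _ _ hn hN hcN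
  have hmix : blockMixingTime G J β 𝓑 ≤ t := by
    refine blockMixingTime_le ht0 fun σ => ?_
    refine (tvDist_blockDynamics_pow_le hε hε1 hN0 hη0 (by linarith) hcon σ
      t).trans (le_trans (mul_le_mul_of_nonneg_right ?_ (Real.exp_pos _).le) ht)
    have e : (2 * Fintype.card V / η : ℝ) = 6 / τ * (Fintype.card V : ℝ) ^ 2 := by
      rw [hη]; field_simp; norm_num
    have h2 : (1 : ℝ) ≤ (Fintype.card V : ℝ) ^ 2 := one_le_pow₀ hn'
    rw [e]
    calc (Fintype.card V : ℝ) * (1 + 6 / τ * (Fintype.card V : ℝ) ^ 2)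
        ≤ Fintype.card V * ((Fintype.card V : ℝ) ^ 2 + 6 / τ * (Fintype.card V : ℝ) ^ 2) := by
          gcongr
      _ = _ := by ring
  calc ((blockMixingTime G J β 𝓑 : ℕ∞) : ENNReal) ≤ ((t : ℕ∞) : ENNReal) := by
        exact_mod_cast hmix
    _ = ENNReal.ofReal t := by simp
    _ ≤ _ := ENNReal.ofReal_le_ofReal htC

end Mixing
end EASpinGlass
end

theorem mainTheorem3 (ε : ℝ) (hε : 0 < ε) :
    ∃ d₀ : ℝ, 1 ≤ d₀ ∧ ∀ d : ℝ, d₀ ≤ d →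
      ∀ β : ℝ, 0 < β → β ≤ (1 - ε) * EASpinGlass.betaC d →
        (∀ (V : Type u) [Fintype V] [DecidableEq V] (G : SimpleGraph V) (J : Sym2 V → ℝ),
          EASpinGlass.InClass d ε G J β →
          ∃ C : ℝ, 0 < C ∧
            ∀ 𝓑 : Finpartition (Finset.univ : Finset V),
              EASpinGlass.IsBlockPartition G J β d ε 𝓑 →
              2 ≤ 𝓑.parts.card →
              ((EASpinGlass.blockMixingTime G J β 𝓑 : ℕ∞) : ENNReal) ≤
                ENNReal.ofReal (C * (𝓑.parts.card * Real.log 𝓑.parts.card))) ∧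
        (∀ c : ℝ, 0 < c → ∃ C : ℝ, 0 < C ∧
          ∀ (V : Type u) [Fintype V] [DecidableEq V] (G : SimpleGraph V) (J : Sym2 V → ℝ),
            EASpinGlass.InClass d ε G J β →
            ∀ 𝓑 : Finpartition (Finset.univ : Finset V),
              EASpinGlass.IsBlockPartition G J β d ε 𝓑 →
              2 ≤ 𝓑.parts.card →
              c * Real.sqrt (Fintype.card V) ≤ 𝓑.parts.card →
              ((EASpinGlass.blockMixingTime G J β 𝓑 : ℕ∞) : ENNReal) ≤
                ENNReal.ofReal (C * (𝓑.parts.card * Real.log 𝓑.parts.card))) := by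
  by_cases hε1 : ε < 1
  · obtain ⟨d₀, hd₀, h⟩ := EASpinGlass.exists_blockMixingTime_le.{u} hε hε1
    refine ⟨d₀, hd₀, fun d hd β hβ _ => ⟨?_, ?_⟩⟩
    · intro V _ _ G J hcl
      -- For a fixed graph `N ≥ 2` already gives `N ≥ c √n` with a suitable `c`.
      have hs := Real.sqrt_nonneg (Fintype.card V : ℝ)
      obtain ⟨C, hC, hmix⟩ := h (1 / (Real.sqrt (Fintype.card V) + 1)) (by positivity)
      refine ⟨C, hC, fun 𝓑 h𝓑 hN => hmix d hd β hβ V G J hcl 𝓑 h𝓑 hN ?_⟩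
      have hN' : (2 : ℝ) ≤ 𝓑.parts.card := by exact_mod_cast hN
      rw [one_div, inv_mul_le_iff₀ (by positivity)]
      nlinarith
    · intro c hc
      obtain ⟨C, hC, hmix⟩ := h c hc
      exact ⟨C, hC, fun V _ _ G J hcl 𝓑 h𝓑 hN hcN => hmix d hd β hβ V G J hcl 𝓑 h𝓑 hN hcN⟩
  · -- For `ε ≥ 1` no `β > 0` lies below `(1 - ε) β_c(d)`.
    refine ⟨1, le_rfl, fun d hd β hβ hβd => absurd hβd (not_le.2 (lt_of_le_of_lt ?_ hβ))⟩
    refine mul_nonpos_of_nonpos_of_nonneg (by linarith [not_lt.1 hε1]) ?_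
    exact div_nonneg (Real.sqrt_nonneg _) (by linarith)
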